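/- Let $(X,d)$ be a complete separable metric space and let $E:X\to\mathbb R\cup\{+\infty\}$ be lower semicontinuous, with dense domain $D(E)=\{E<\infty\}$, and bounded from below on every $d$-bounded set. The slope of $E$ is $|\partial E|(x)=+\infty$ if $x\notin D(E)$, and $|\partial E|(x)=\limsup_{y\to x}\frac{[E(x)-E(y)]^+}{d(x,y)}$ if $x\in D(E)$ (with value $0$ if $x$ is isolated). For $\lambda\in\mathbb R$, an $\mathrm{EVI}_\lambda$-gradient flow of $E$ starting from $x\in X$ is a locally absolutely continuous curve $(\gamma_t)_{t>0}$ in $X$ with $\gamma_t\to x$ as $t\downarrow0$ such that for every $y\in X$ $$\tfrac12\tfrac{\mathrm d}{\mathrm dt}d^2(\gamma_t,y)+\tfrac\lambda2 d^2(\gamma_t,y)+E(\gamma_t)\le E(y)\qquad\text{for a.e. }t>0.$$ Assume that for some $\lambda\in\mathbb R$ such a flow exists from every $x\in X$. It is then unique, and we write $S_tx$ for its value at time $t>0$, and $S_0x=x$. For $\gamma\in C([0,1],X)$ and $\varepsilon>0$ put $$\mathcal A(\gamma)=\tfrac12\int_0^1|\dot\gamma_t|^2\,\mathrm dt,\qquad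 \mathcal A_\varepsilon(\gamma)=\mathcal A(\gamma)+\tfrac{\varepsilon^2}2\int_0^1|\partial E|^2(\gamma_t)\,\mathrm dt,$$ where $|\dot\gamma_t|$ is the metric speed and $\mathcal A(\gamma)=+\infty$ if $\gamma$ is not absolutely continuous. Let $x,y\in X$, where $E(x)=+\infty$ or $E(y)=+\infty$ is allowed, let $\varepsilon_n>0$ with $\varepsilon_n\to0$, and let $\eta_n\ge0$ with $\eta_n\to0$ slowly enough that $$\varepsilon_n\big(E(S_{\eta_n}x)+E(S_{\eta_n}y)\big)\to0 .$$ Let $\iota_{01}(\gamma)=0$ if $\gamma_0=x$ and $\gamma_1=y$, and $\iota_{01}(\gamma)=+\infty$ otherwise; let $\iota^n_{01}(\gamma)=0$ if $\gamma_0=S_{\eta_n}x$ and $\gamma_1=S_{\eta_n}y$, and $\iota^n_{01}(\gamma)=+\infty$ otherwise. Then $$\Gamma\text{-}\lim_{n\to\infty}\big\{\mathcal A_{\varepsilon_n}+\iota^n_{01}\big\}=\mathcal A+\iota_{01}$$ with respect to uniform convergence on $C([0,1],X)$. That is: (i) $\mathcal A(\gamma)+\iota_{01}(\gamma)\le\liminf_n\{\mathcal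 A_{\varepsilon_n}(\gamma^n)+\iota_{01}^n(\gamma^n)\}$ whenever $\gamma^n\to\gamma$, and (ii) for every $\gamma\in C([0,1],X)$ there is a sequence $\gamma^n\to\gamma$ with $\limsup_n\{\mathcal A_{\varepsilon_n}(\gamma^n)+\iota_{01}^n(\gamma^n)\}\le\mathcal A(\gamma)+\iota_{01}(\gamma)$. Moreover, let $\sigma$ be any Hausdorff topology on $X$ such that every $d$-bounded sequence has a $\sigma$-converging subsequence (with limit in $X$) and such that $d$ and $|\partial E|$ are sequentially $\sigma$-lower semicontinuous. Then (i) and (ii) also hold when $\gamma^n\to\gamma$ is understood as $\gamma^n_t\to\gamma_t$ in $\sigma$ for every $t\in[0,1]$. -/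

import Mathlib

open Set Filter Topology MeasureTheory
open scoped ENNReal

noncomputable section

namespace MetricSchrodinger

variable {X : Type*} [MetricSpace X]

/-- The slope `|∂E|` of `E : X → ℝ ∪ {+∞}`: it is `+∞` off the domain of `E`, and
`limsup_{y → x, y ≠ x} [E x - E y]⁺ / d(x, y)` on the domain. At an isolated point `𝓝[≠] x` is
the bottom filter, so the `limsup` is `0` there. -/
def slope (E : X → EReal) (x : X) : ℝ≥0∞ :=
  open Classical in
  if E x = ⊤ then ⊤
  else limsup (fun y => (E x - E y).toENNReal / edist x y) (𝓝[≠] x)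

/-- `γ`, restricted to `(0, ∞)`, is a gradient flow of `E` in the `EVI_λ` sense. The function
`s ↦ d²(γ s, y)` is locally absolutely continuous on `(0, ∞)` by the first field, so its derivative
exists at almost every `t > 0`. -/
structure IsEVIFlow (E : X → EReal) (lam : ℝ) (γ : ℝ → X) : Prop where
  locally_ac : ∀ a b : ℝ, 0 < a → a ≤ b → AbsolutelyContinuousOnInterval γ a b
  evi : ∀ y : X, ∀ᵐ t ∂(volume.restrict (Ioi (0 : ℝ))),
    (((1 / 2) * deriv (fun s => dist (γ s) y ^ 2) t + (lam / 2) * dist (γ t) y ^ 2 : ℝ) : EReal)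
      + E (γ t) ≤ E y

/-- `γ` is an `EVI_λ`-gradient flow of `E` starting at `x`. -/
structure IsEVIFlowFrom (E : X → EReal) (lam : ℝ) (x : X) (γ : ℝ → X) : Prop
    extends IsEVIFlow E lam γ where
  tendsto_start : Tendsto γ (𝓝[>] 0) (𝓝 x)

/-- The standing assumptions on `E : X → ℝ ∪ {+∞}`; completeness and separability of `X` are
type class assumptions. -/
structure StandingAssumptions (E : X → EReal) (lam : ℝ) : Prop where
  ne_bot : ∀ x, E x ≠ ⊥
  lsc : LowerSemicontinuous E
  dense_domain : Dense {x | E x ≠ ⊤}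
  bddBelow_of_isBounded : ∀ B : Set X, Bornology.IsBounded B →
    ∃ c : ℝ, ∀ x ∈ B, (c : EReal) ≤ E x
  exists_flow : ∀ x : X, ∃ γ : ℝ → X, IsEVIFlowFrom E lam x γ

/-- The semigroup `S_t x`: the value at time `t > 0` of the (unique) `EVI_λ`-gradient flow of `E`
starting at `x`, and `S_0 x = x`. -/
def semigroup (E : X → EReal) (lam : ℝ) (t : ℝ) (x : X) : X :=
  open Classical in
  if h : 0 < t ∧ ∃ γ : ℝ → X, IsEVIFlowFrom E lam x γ then h.2.choose t else x

/-- The metric speed `|γ̇_t| = lim_{s → t} d(γ_s, γ_t) / |s - t|`. For an absolutely continuous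
curve the limit exists at almost every `t`; the upper limit makes it total. -/
def metricSpeed (γ : ℝ → X) (t : ℝ) : ℝ≥0∞ :=
  limsup (fun s => edist (γ s) (γ t) / edist s t) (𝓝[≠] t)

/-- The space `C([0,1], X)` of curves that are continuous with respect to the distance of `X`. It is
named so that a second topology `σ` on `X` can never be picked up in its place. -/
abbrev Curve (X : Type*) [MetricSpace X] : Type _ := C(unitInterval, X)

/-- A curve `[0,1] → X` as a function on `ℝ`, constant on `(-∞, 0]` and on `[1, ∞)`. -/
def extend (γ : Curve X) : ℝ → X :=
  fun t => γ (projIcc 0 1 zero_le_one t)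

/-- The kinetic energy `½ ∫₀¹ |γ̇_t|² dt`, which is `+∞` if `γ` is not absolutely continuous. -/
def kineticEnergy (γ : Curve X) : ℝ≥0∞ :=
  open Classical in
  if AbsolutelyContinuousOnInterval (extend γ) 0 1 then
    (1 / 2) * ∫⁻ t in Icc (0 : ℝ) 1, metricSpeed (extend γ) t ^ 2
  else ⊤

/-- The halved Fisher information `½ ∫₀¹ |∂E|²(γ_t) dt`. -/
def fisherInformation (E : X → EReal) (γ : Curve X) : ℝ≥0∞ :=
  (1 / 2) * ∫⁻ t in Icc (0 : ℝ) 1, slope E (extend γ t) ^ 2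

/-- The action `A_ε = A + ε² I`. -/
def action (E : X → EReal) (ε : ℝ) (γ : Curve X) : ℝ≥0∞ :=
  kineticEnergy γ + ENNReal.ofReal (ε ^ 2) * fisherInformation E γ

/-- The convex indicator of the constraints `γ_0 = x`, `γ_1 = y`. -/
def endpointIndicator (x y : X) (γ : Curve X) : ℝ≥0∞ :=
  open Classical in
  if γ 0 = x ∧ γ 1 = y then 0 else ⊤

/-- `F` is the (sequential) `Γ`-limit of `Fn n` as `n → ∞` with respect to a notion `conv` of
convergence of sequences: the `Γ`-liminf inequality along every converging sequence, and a
recovery sequence for every point. -/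
def GammaConverges {Z : Type*} (conv : (ℕ → Z) → Z → Prop) (Fn : ℕ → Z → ℝ≥0∞)
    (F : Z → ℝ≥0∞) : Prop :=
  (∀ (u : ℕ → Z) (z : Z), conv u z → F z ≤ liminf (fun n => Fn n (u n)) atTop) ∧
  (∀ z : Z, ∃ u : ℕ → Z, conv u z ∧ limsup (fun n => Fn n (u n)) atTop ≤ F z)

/-- Uniform convergence of curves with respect to the distance of `X`. -/
def UniformConv (u : ℕ → Curve X) (γ : Curve X) : Prop :=
  TendstoUniformly (fun n t => u n t) (fun t => γ t) atTop

/-- Convergence of `d`-continuous curves in the pointwise-in-time `σ`-topology. -/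
def PointwiseConv (σ : TopologicalSpace X) (u : ℕ → Curve X)
    (γ : Curve X) : Prop :=
  ∀ t : unitInterval, Tendsto (fun n => u n t) atTop (@nhds X σ (γ t))

/-- `σ` is a Hausdorff topology on `X` for which every `d`-bounded sequence has a `σ`-converging
subsequence, and `d` and `|∂E|` are sequentially lower semicontinuous. -/
structure SigmaAssumption (E : X → EReal) (σ : TopologicalSpace X) : Prop where
  hausdorff : @T2Space X σ
  seq_compact : ∀ B : Set X, Bornology.IsBounded B → ∀ u : ℕ → X, (∀ n, u n ∈ B) →
    ∃ (z : X) (φ : ℕ → ℕ), StrictMono φ ∧ Tendsto (fun k => u (φ k)) atTop (@nhds X σ z)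
  dist_seq_lsc : ∀ (u v : ℕ → X) (a b : X), Tendsto u atTop (@nhds X σ a) →
    Tendsto v atTop (@nhds X σ b) → edist a b ≤ liminf (fun n => edist (u n) (v n)) atTop
  slope_seq_lsc : ∀ (u : ℕ → X) (a : X), Tendsto u atTop (@nhds X σ a) →
    slope E a ≤ liminf (fun n => slope E (u n)) atTop

end MetricSchrodinger

end

noncomputable section

namespace MetricSchrodinger

variable {X : Type*} [MetricSpace X]

/-! The lower bound rests on lower semicontinuity of the kinetic energy. The Fisher term is
nonnegative and can be dropped. Each `discreteEnergy` lies below the kinetic energy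
(`ofReal_discreteEnergy_le_kineticEnergy`), and their liminf lies above it
(`kineticEnergy_le_liminf_discreteEnergy`). A discrete energy is a finite sum of squared distances,
so any convergence along which distances are lower semicontinuous will do.

The recovery curve runs the flow along γ itself: u_t = S_{h(t)} γ_t with h(t) = η + ε min(t, 1 - t).
It has the prescribed end points and converges uniformly to γ. Its action is estimated on a grid
with N cells and δ = ε/N. The EVI for the flow from p between times h and h + δ, tested against S_h
q, gives, up to factors tending to 1 as δ, h → 0, ½ d²(S_{h+δ}p, S_h q) + ½ δ² |∂E|²(S_{h+δ}p) + δ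
(E(S_{h+δ}p) - E(S_h q)) ≤ ½ d²(p, q) (`semigroup_comparison`). After multiplication by N and
summation over the cells, the first terms form a discrete kinetic energy, the second a Riemann sum
for the Fisher term, and the energies telescope on each half of [0,1]. As N → ∞ this yields A_ε(u) ≤
e^{2|λ|(η+ε)} A(γ) + ε (E(S_η x) + E(S_η y) - 2 E(u_{1/2})) (`action_recoveryCurve_le`). The
assumption on η_n and the lower bound of E on bounded sets control the last term.

The squared slope enters through dissipation. At a time where the energy is differentiable, the
speed squared is at most -dE/dt (`IntegratedEVI.eventually_dist_le`), and speed bounds the slope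
(`IntegratedEVI.slopeBound_of_frequently`). Contraction carries the bound to every later time
(`IntegratedEVI.globalSlope_sq_le`). All of this is done for `globalSlope`, which dominates the
slope and is lower semicontinuous. -/

/-! ### Absolutely continuous curves and an increment criterion for decrease. -/

theorem absolutelyContinuousOnInterval_dist {f : ℝ → X} {a b : ℝ}
    (hf : AbsolutelyContinuousOnInterval f a b) (y : X) :
    AbsolutelyContinuousOnInterval (fun s => dist (f s) y) a b := by
  rw [absolutelyContinuousOnInterval_iff] at hf ⊢
  intro ε hε
  obtain ⟨δ, hδ, h⟩ := hf ε hε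
  refine ⟨δ, hδ, fun I hI hl => lt_of_le_of_lt (Finset.sum_le_sum fun i _ => ?_) (h I hI hl)⟩
  exact dist_dist_dist_le_left _ _ _

theorem continuousOn_of_absolutelyContinuousOnInterval {f : ℝ → X} {a b : ℝ}
    (hf : AbsolutelyContinuousOnInterval f a b) : ContinuousOn f (uIcc a b) := by
  intro t ht
  have h := (absolutelyContinuousOnInterval_dist hf (f t)).continuousOn t ht
  rw [ContinuousWithinAt, dist_self] at h
  exact tendsto_iff_dist_tendsto_zero.2 h

/-- A function whose increments over `[s, t]` are bounded by `(t - s)` times the increments of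
another function does not increase. -/
theorem le_of_increment_le_mul {G m : ℝ → ℝ} {a b : ℝ} (hab : a ≤ b)
    (h : ∀ s t, a ≤ s → s ≤ t → t ≤ b → G t - G s ≤ (t - s) * (m s - m t)) : G b ≤ G a := by
  -- On a partition into N + 1 equal pieces the increments of `m` telescope, so one factor 1 / (N +
  -- 1) survives.
  have key : ∀ N : ℕ, G b - G a ≤ (b - a) * (m a - m b) * (1 / ((N : ℝ) + 1)) := by
    intro N
    have hN : (0 : ℝ) < (N : ℝ) + 1 := by positivity
    set p : ℕ → ℝ := fun i => a + (b - a) / (N + 1) * i with hp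
    have hd : 0 ≤ (b - a) / ((N : ℝ) + 1) := div_nonneg (by linarith) hN.le
    have hp0 : p 0 = a := by simp [hp]
    have hpN : p (N + 1) = b := by simp only [hp]; push_cast; field_simp; ring
    have hmono : Monotone p := by
      intro i j hij
      have : (i : ℝ) ≤ j := by exact_mod_cast hij
      simp only [hp]
      gcongr
    have hstep : ∀ i ∈ Finset.range (N + 1),
        G (p (i + 1)) - G (p i) ≤ (b - a) / (N + 1) * (m (p i) - m (p (i + 1))) := by
      intro i hi
      have hi' := Finset.mem_range.1 hi
      have := h (p i) (p (i + 1)) (hp0 ▸ hmono (Nat.zero_le i)) (hmono (Nat.le_succ i))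
        (hpN ▸ hmono hi')
      have e : p (i + 1) - p i = (b - a) / (N + 1) := by simp only [hp]; push_cast; ring
      rwa [e] at this
    have hsum := Finset.sum_le_sum hstep
    rw [← Finset.mul_sum, Finset.sum_range_sub (fun i => G (p i)),
      Finset.sum_range_sub' (fun i => m (p i)), hp0, hpN] at hsum
    calc G b - G a ≤ _ := hsum
      _ = _ := by ring
  have hlim := (tendsto_one_div_add_atTop_nhds_zero_nat (𝕜 := ℝ)).const_mul
    ((b - a) * (m a - m b))
  have := ge_of_tendsto' hlim key
  linarith

/-! ### EVI flows: decay and finiteness of the energy. -/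

section Flow

variable {E : X → EReal} {lam : ℝ} {u : ℝ → X}

theorem IsEVIFlow.absolutelyContinuousOnInterval_exp_mul_dist_sq (h : IsEVIFlow E lam u) (y : X)
    {a b : ℝ} (ha : 0 < a) (hab : a ≤ b) :
    AbsolutelyContinuousOnInterval (fun r => Real.exp (lam * r) / 2 * dist (u r) y ^ 2) a b := by
  have h1 := absolutelyContinuousOnInterval_dist (h.locally_ac a b ha hab) y
  have h2 : AbsolutelyContinuousOnInterval (fun r => Real.exp (lam * r) / 2) a b := by
    apply ContDiffOn.absolutelyContinuousOnInterval
    fun_prop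
  have h3 := h2.mul (h1.mul h1)
  convert h3 using 1
  ext r
  simp [sq]

/-- The weight exp(λt) absorbs the term λ/2 d² of the EVI. Finiteness of the energy at almost every
time is forced by the finite right-hand side. -/
theorem IsEVIFlow.ae_deriv_le (h : IsEVIFlow E lam u) (hbot : ∀ x, E x ≠ ⊥) {y : X}
    (hy : E y ≠ ⊤) {a b : ℝ} (ha : 0 < a) (hab : a ≤ b) :
    ∀ᵐ t, t ∈ Icc a b → E (u t) ≠ ⊤ ∧
      deriv (fun r => Real.exp (lam * r) / 2 * dist (u r) y ^ 2) t ≤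
        Real.exp (lam * t) * ((E y).toReal - (E (u t)).toReal) := by
  have h1 := absolutelyContinuousOnInterval_dist (h.locally_ac a b ha hab) y
  have h2 := (h1.mul h1).ae_differentiableAt
  have h3 := (ae_restrict_iff' measurableSet_Ioi).1 (h.evi y)
  filter_upwards [h2, h3] with t ht2 ht3 ht
  have ht0 : 0 < t := lt_of_lt_of_le ha ht.1
  have hev := ht3 ht0
  have hd : DifferentiableAt ℝ (fun s => dist (u s) y ^ 2) t := by
    have := ht2 (by rwa [uIcc_of_le hab])
    convert this using 1
    ext s; simp [sq]
  have htop : E (u t) ≠ ⊤ := by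
    intro htop
    rw [htop, EReal.coe_add_top] at hev
    exact hy (top_le_iff.1 hev)
  refine ⟨htop, ?_⟩
  have hder : HasDerivAt (fun r => Real.exp (lam * r) / 2 * dist (u r) y ^ 2)
      (Real.exp (lam * t) * lam / 2 * dist (u t) y ^ 2 +
        Real.exp (lam * t) / 2 * deriv (fun s => dist (u s) y ^ 2) t) t := by
    have e1 : HasDerivAt (fun r => Real.exp (lam * r) / 2) (Real.exp (lam * t) * lam / 2) t := by
      have := (((hasDerivAt_id t).const_mul lam).exp).div_const 2
      simpa using this
    exact e1.mul hd.hasDerivAt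
  rw [hder.deriv]
  lift E y to ℝ using ⟨hy, hbot y⟩ with Ey hEy
  lift E (u t) to ℝ using ⟨htop, hbot _⟩ with Eu hEu
  have hev' : (1 / 2) * deriv (fun s => dist (u s) y ^ 2) t + (lam / 2) * dist (u t) y ^ 2 + Eu
      ≤ Ey := by exact_mod_cast hev
  simp only [EReal.toReal_coe]
  nlinarith [mul_le_mul_of_nonneg_left hev' (Real.exp_pos (lam * t)).le]

/-- If the energy were larger at `b`, let `s` be the last time in [a, b] with energy at most E(u a).
Tested against u s, the EVI makes the weighted squared distance to u s strictly decrease after `s`,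
although it starts from 0. -/
theorem IsEVIFlow.energy_antitone (h : IsEVIFlow E lam u) (hbot : ∀ x, E x ≠ ⊥)
    (hlsc : LowerSemicontinuous E) {a b : ℝ} (ha : 0 < a) (hab : a ≤ b) : E (u b) ≤ E (u a) := by
  by_contra hcon
  push Not at hcon
  have hucont : ContinuousOn u (Icc a b) := by
    have := continuousOn_of_absolutelyContinuousOnInterval (h.locally_ac a b ha hab)
    rwa [uIcc_of_le hab] at this
  have hne : E (u a) ≠ ⊤ := hcon.ne_top
  have hcomp : IsCompact {r ∈ Icc a b | E (u r) ≤ E (u a)} := by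
    have hcl := hucont.preimage_isClosed_of_isClosed isClosed_Icc (hlsc.isClosed_preimage (E (u a)))
    exact isCompact_Icc.of_isClosed_subset hcl inter_subset_left
  obtain ⟨s, hs, hmax⟩ := hcomp.exists_isGreatest ⟨a, ⟨le_refl a, hab⟩, le_refl _⟩
  have hs0 : 0 < s := lt_of_lt_of_le ha hs.1.1
  have hsb : s < b := lt_of_le_of_ne hs.1.2 (by rintro rfl; exact absurd hs.2 (not_le.2 hcon))
  have hys : E (u s) ≠ ⊤ := ne_top_of_le_ne_top hne hs.2
  have hac := h.absolutelyContinuousOnInterval_exp_mul_dist_sq (u s) hs0 hsb.le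
  have hftc := hac.integral_deriv_eq_sub
  have hlt : ∀ᵐ t, t ∈ Ioc s b →
      deriv (fun r => Real.exp (lam * r) / 2 * dist (u r) (u s) ^ 2) t < 0 := by
    filter_upwards [h.ae_deriv_le hbot hys hs0 hsb.le] with t ht hts
    obtain ⟨htop, hle⟩ := ht ⟨hts.1.le, hts.2⟩
    refine lt_of_le_of_lt hle ?_
    have hgt : E (u s) < E (u t) := by
      refine lt_of_le_of_lt hs.2 (lt_of_not_ge fun hle => ?_)
      exact absurd (hmax ⟨⟨hs.1.1.trans hts.1.le, hts.2⟩, hle⟩) (not_le.2 hts.1)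
    have : (E (u s)).toReal < (E (u t)).toReal := by
      rwa [← EReal.coe_lt_coe_iff, EReal.coe_toReal hys (hbot _), EReal.coe_toReal htop (hbot _)]
    exact mul_neg_of_pos_of_neg (Real.exp_pos _) (by linarith)
  have hneg : (∫ t in s..b, deriv (fun r => Real.exp (lam * r) / 2 * dist (u r) (u s) ^ 2) t)
      < ∫ t in s..b, (0 : ℝ) := by
    apply intervalIntegral.integral_lt_integral_of_ae_le_of_measure_setOfPred_lt_ne_zero hsb.le
      hac.intervalIntegrable_deriv intervalIntegrable_const
    · rw [EventuallyLE, ae_restrict_iff' measurableSet_Ioc]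
      filter_upwards [hlt] with t ht hts using (ht hts).le
    · intro hzero
      have h0 : ∀ᵐ t ∂(volume.restrict (Ioc s b)), False := by
        have h1 : ∀ᵐ t ∂(volume.restrict (Ioc s b)),
            ¬ deriv (fun r => Real.exp (lam * r) / 2 * dist (u r) (u s) ^ 2) t < 0 := by
          rw [ae_iff]; simpa using hzero
        filter_upwards [h1, (ae_restrict_iff' measurableSet_Ioc).2 hlt] with t h1 h2 using h1 h2
      have : volume.restrict (Ioc s b) = 0 := ae_eq_bot.1 (eventually_false_iff_eq_bot.1 h0)
      rw [Measure.restrict_eq_zero] at this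
      simp at this
      linarith
  rw [hftc] at hneg
  simp at hneg
  have : 0 ≤ Real.exp (lam * b) / 2 * dist (u b) (u s) ^ 2 := by positivity
  linarith

theorem IsEVIFlow.energy_ne_top (h : IsEVIFlow E lam u) (hE : StandingAssumptions E lam) {t : ℝ}
    (ht : 0 < t) : E (u t) ≠ ⊤ := by
  obtain ⟨y, hy⟩ := hE.dense_domain.nonempty_iff.2 ⟨u t⟩
  have hae := h.ae_deriv_le hE.ne_bot hy (half_pos ht) (half_le_self ht.le)
  have : ∃ r ∈ Icc (t / 2) t, E (u r) ≠ ⊤ := by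
    by_contra hcon
    push Not at hcon
    have h0 : volume (Icc (t / 2) t) = 0 := by
      refine measure_mono_null ?_ (ae_iff.1 hae)
      intro r hr
      simp only [mem_ofPred_eq]
      exact fun hh => (hh hr).1 (hcon r hr)
    simp at h0
    linarith
  obtain ⟨r, hr, hfin⟩ := this
  exact ne_top_of_le_ne_top hfin
    (h.energy_antitone hE.ne_bot hE.lsc (lt_of_lt_of_le (half_pos ht) hr.1) hr.2)

end Flow

/-! ### The integrated EVI and contraction of flows. -/

/-- The integrated form of the evolution variational inequality, along a curve of finite and
nonincreasing energy. -/
structure IntegratedEVI (E : X → EReal) (lam : ℝ) (u : ℝ → X) : Prop where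
  continuousOn : ContinuousOn u (Ioi 0)
  energy_ne_top : ∀ t, 0 < t → E (u t) ≠ ⊤
  antitoneOn : AntitoneOn (fun t => (E (u t)).toReal) (Ioi 0)
  evi : ∀ s t y, 0 < s → s ≤ t → E y ≠ ⊤ →
    Real.exp (lam * t) / 2 * dist (u t) y ^ 2 - Real.exp (lam * s) / 2 * dist (u s) y ^ 2 ≤
      ∫ r in s..t, Real.exp (lam * r) * ((E y).toReal - (E (u r)).toReal)

section Integrated

variable {E : X → EReal} {lam : ℝ} {u w : ℝ → X}

theorem intervalIntegrable_exp_mul_sub {e : ℝ → ℝ} (he : AntitoneOn e (Ioi 0)) (c : ℝ)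
    {s t : ℝ} (hs : 0 < s) (hst : s ≤ t) :
    IntervalIntegrable (fun r => Real.exp (lam * r) * (c - e r)) volume s t := by
  have hsub : uIcc s t ⊆ Ioi 0 := by
    rw [uIcc_of_le hst]; exact fun r hr => lt_of_lt_of_le hs hr.1
  have h1 : IntervalIntegrable (fun r => c - e r) volume s t :=
    intervalIntegrable_const.sub (he.mono hsub).intervalIntegrable
  refine h1.continuousOn_mul ?_
  fun_prop

theorem IsEVIFlow.integratedEVI (h : IsEVIFlow E lam u) (hE : StandingAssumptions E lam) :
    IntegratedEVI E lam u where
  continuousOn := by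
    intro t ht
    have ht : 0 < t := ht
    have := continuousOn_of_absolutelyContinuousOnInterval
      (h.locally_ac (t / 2) (t + 1) (half_pos ht) (by linarith))
    rw [uIcc_of_le (by linarith)] at this
    exact (this.continuousAt (Icc_mem_nhds (by linarith) (by linarith))).continuousWithinAt
  energy_ne_top t ht := h.energy_ne_top hE ht
  antitoneOn s hs t ht hst := EReal.toReal_le_toReal (h.energy_antitone hE.ne_bot hE.lsc hs hst)
    (hE.ne_bot _) (h.energy_ne_top hE hs)
  evi s t y hs hst hy := by
    have hac := h.absolutelyContinuousOnInterval_exp_mul_dist_sq y hs hst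
    rw [← hac.integral_deriv_eq_sub]
    refine intervalIntegral.integral_mono_ae_restrict hst hac.intervalIntegrable_deriv
      (intervalIntegrable_exp_mul_sub (fun s hs t ht hst => EReal.toReal_le_toReal
        (h.energy_antitone hE.ne_bot hE.lsc hs hst) (hE.ne_bot _) (h.energy_ne_top hE hs))
        _ hs hst) ?_
    rw [EventuallyLE, ae_restrict_iff' measurableSet_Icc]
    filter_upwards [h.ae_deriv_le hE.ne_bot hy hs hst] with r hr hrs using (hr hrs).2

theorem IntegratedEVI.shift (h : IntegratedEVI E lam u) {τ : ℝ} (hτ : 0 ≤ τ) :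
    IntegratedEVI E lam (fun t => u (t + τ)) where
  continuousOn := h.continuousOn.comp (by fun_prop)
    (fun t ht => by simp only [mem_Ioi] at ht ⊢; linarith)
  energy_ne_top t ht := h.energy_ne_top _ (by linarith)
  antitoneOn s hs t ht hst := h.antitoneOn (by simp only [mem_Ioi] at *; linarith)
    (by simp only [mem_Ioi] at *; linarith) (by linarith)
  evi s t y hs hst hy := by
    have := h.evi (s + τ) (t + τ) y (by linarith) (by linarith) hy
    rw [← intervalIntegral.integral_comp_add_right] at this
    have hexp : ∀ r, Real.exp (lam * (r + τ)) = Real.exp (lam * τ) * Real.exp (lam * r) := by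
      intro r; rw [← Real.exp_add]; ring_nf
    simp only [hexp, mul_assoc, intervalIntegral.integral_const_mul] at this
    have hpos := Real.exp_pos (lam * τ)
    refine le_of_mul_le_mul_left ?_ hpos
    linarith

theorem IntegratedEVI.evi_endpoint (h : IntegratedEVI E lam u) {s t : ℝ} {y : X} (hs : 0 < s)
    (hst : s ≤ t) (hy : E y ≠ ⊤) :
    Real.exp (lam * t) / 2 * dist (u t) y ^ 2 - Real.exp (lam * s) / 2 * dist (u s) y ^ 2 ≤
      (∫ r in s..t, Real.exp (lam * r)) * ((E y).toReal - (E (u t)).toReal) := by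
  refine (h.evi s t y hs hst hy).trans ?_
  rw [← intervalIntegral.integral_mul_const]
  refine intervalIntegral.integral_mono_on hst
    (intervalIntegrable_exp_mul_sub h.antitoneOn _ hs hst)
    (Continuous.intervalIntegrable (by fun_prop) _ _) fun r hr => ?_
  have := h.antitoneOn (lt_of_lt_of_le hs hr.1) (lt_of_lt_of_le hs hst) hr.2
  have hpos := Real.exp_pos (lam * r)
  simp only at this
  gcongr

theorem exp_mul_le_exp_abs_mul {b r : ℝ} (hr : 0 ≤ r) (hrb : r ≤ b) :
    Real.exp (lam * r) ≤ Real.exp (|lam| * b) := by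
  apply Real.exp_le_exp.2
  calc lam * r ≤ |lam| * r := by gcongr; exact le_abs_self _
    _ ≤ |lam| * b := by gcongr

theorem abs_exp_mul_sub_exp_mul_le {b s t : ℝ} (hs : 0 ≤ s) (hst : s ≤ t) (htb : t ≤ b) :
    |Real.exp (lam * t) - Real.exp (lam * s)| ≤ |lam| * Real.exp (|lam| * b) * (t - s) := by
  have := Convex.norm_image_sub_le_of_norm_hasDerivWithin_le (f := fun r => Real.exp (lam * r))
    (f' := fun r => Real.exp (lam * r) * lam) (C := |lam| * Real.exp (|lam| * b))
    (s := Icc s t) (x := s) (y := t) ?_ ?_ (convex_Icc _ _) ⟨le_refl _, hst⟩ ⟨hst, le_refl _⟩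
  · simpa [Real.norm_eq_abs, abs_of_nonneg (sub_nonneg.2 hst)] using this
  · intro r _
    have := ((hasDerivAt_id r).const_mul lam).exp
    simp only [id, mul_one] at this
    exact this.hasDerivWithinAt
  · intro r hr
    rw [norm_mul, Real.norm_eq_abs, Real.norm_eq_abs, abs_of_pos (Real.exp_pos _), mul_comm]
    exact mul_le_mul_of_nonneg_left (exp_mul_le_exp_abs_mul (hs.trans hr.1) (hr.2.trans htb))
      (abs_nonneg _)

theorem integral_exp_mul_mem {b s t : ℝ} (hs : 0 ≤ s) (hst : s ≤ t) (htb : t ≤ b) :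
    0 ≤ ∫ r in s..t, Real.exp (lam * r) ∧
      ∫ r in s..t, Real.exp (lam * r) ≤ Real.exp (|lam| * b) * (t - s) := by
  constructor
  · exact intervalIntegral.integral_nonneg hst fun r _ => (Real.exp_pos _).le
  · calc ∫ r in s..t, Real.exp (lam * r) ≤ ∫ r in s..t, Real.exp (|lam| * b) :=
        intervalIntegral.integral_mono_on hst
          (Continuous.intervalIntegrable (by fun_prop) _ _) intervalIntegrable_const
          fun r hr => exp_mul_le_exp_abs_mul (hs.trans hr.1) (hr.2.trans htb)
      _ = _ := by simp [mul_comm]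

/-- Doubling of variables without derivatives: over [s, t] the flow `u` is tested against w t and
`w` against u s. With weights exp(λt) and exp(λs) the mixed distances cancel, and the remaining
energy terms are bounded by (t - s) times the increment of a function, so `le_of_increment_le_mul`
applies. -/
theorem IntegratedEVI.contraction (hu : IntegratedEVI E lam u) (hw : IntegratedEVI E lam w)
    {a b : ℝ} (ha : 0 < a) (hab : a ≤ b) :
    Real.exp (lam * b) * dist (u b) (w b) ≤ Real.exp (lam * a) * dist (u a) (w a) := by
  set eu : ℝ → ℝ := fun t => (E (u t)).toReal with heu
  set ew : ℝ → ℝ := fun t => (E (w t)).toReal with hew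
  set C := Real.exp (|lam| * b) with hC
  -- By monotonicity of both energies, `M` bounds their difference throughout [a, b].
  set M := |ew a - eu b| + |ew b - eu a| with hM
  have hCpos : 0 < C := Real.exp_pos _
  have key := le_of_increment_le_mul
    (G := fun t => Real.exp (lam * t) ^ 2 / 2 * dist (u t) (w t) ^ 2)
    (m := fun t => C ^ 2 * eu t - C ^ 2 * |lam| * M * t) hab ?_
  · have hb := Real.exp_pos (lam * b)
    have ha' := Real.exp_pos (lam * a)
    refine le_of_sq_le_sq ?_ (by positivity)
    nlinarith
  intro s t has hst htb
  have hs0 : 0 < s := lt_of_lt_of_le ha has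
  have ht0 : 0 < t := lt_of_lt_of_le hs0 hst
  have hb0 : 0 < b := lt_of_lt_of_le ht0 htb
  have h1 := hu.evi_endpoint hs0 hst (hw.energy_ne_top t ht0)
  have h2 := hw.evi_endpoint hs0 hst (hu.energy_ne_top s hs0)
  rw [dist_comm (w t), dist_comm (w s)] at h2
  obtain ⟨hJ0, hJ⟩ := integral_exp_mul_mem (lam := lam) hs0.le hst htb
  set J := ∫ r in s..t, Real.exp (lam * r) with hJdef
  have hexp := abs_exp_mul_sub_exp_mul_le (lam := lam) hs0.le hst htb
  have hq := exp_mul_le_exp_abs_mul (lam := lam) hs0.le (hst.trans htb)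
  have hps := Real.exp_pos (lam * s)
  have hpt := Real.exp_pos (lam * t)
  have hmon : eu t ≤ eu s := hu.antitoneOn hs0 ht0 hst
  have hMt : |ew t - eu t| ≤ M := by
    have e1 : eu b ≤ eu t := hu.antitoneOn ht0 hb0 htb
    have e2 : eu t ≤ eu a := hu.antitoneOn ha ht0 (has.trans hst)
    have e3 : ew b ≤ ew t := hw.antitoneOn ht0 hb0 htb
    have e4 : ew t ≤ ew a := hw.antitoneOn ha ht0 (has.trans hst)
    rw [abs_le]
    have := neg_abs_le (ew b - eu a)
    have := le_abs_self (ew a - eu b)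
    have := abs_nonneg (ew b - eu a)
    have := abs_nonneg (ew a - eu b)
    constructor <;> linarith
  have hbr : Real.exp (lam * s) * (eu s - eu t) +
      (Real.exp (lam * t) - Real.exp (lam * s)) * (ew t - eu t) ≤
      C * (eu s - eu t) + |lam| * C * (t - s) * M := by
    have t1 : Real.exp (lam * s) * (eu s - eu t) ≤ C * (eu s - eu t) :=
      mul_le_mul_of_nonneg_right hq (by linarith)
    have t2 : (Real.exp (lam * t) - Real.exp (lam * s)) * (ew t - eu t) ≤
        |lam| * C * (t - s) * M := by
      refine (le_abs_self _).trans ?_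
      rw [abs_mul]
      exact mul_le_mul hexp hMt (abs_nonneg _) ((abs_nonneg _).trans hexp)
    linarith
  have hR0 : 0 ≤ C * (eu s - eu t) + |lam| * C * (t - s) * M := by
    have : 0 ≤ M := (abs_nonneg _).trans hMt
    have := abs_nonneg lam
    have : 0 ≤ t - s := by linarith
    have : 0 ≤ eu s - eu t := by linarith
    positivity
  have h1' := mul_le_mul_of_nonneg_left h1 hpt.le
  have h2' := mul_le_mul_of_nonneg_left h2 hps.le
  have h3 := mul_le_mul_of_nonneg_left hbr hJ0
  have h4 := mul_le_mul_of_nonneg_right hJ hR0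
  simp only [heu, hew] at *
  calc _ = Real.exp (lam * t) * (Real.exp (lam * t) / 2 * dist (u t) (w t) ^ 2 -
          Real.exp (lam * s) / 2 * dist (u s) (w t) ^ 2) +
        Real.exp (lam * s) * (Real.exp (lam * t) / 2 * dist (u s) (w t) ^ 2 -
          Real.exp (lam * s) / 2 * dist (u s) (w s) ^ 2) := by ring
    _ ≤ _ := add_le_add h1' h2'
    _ = J * (Real.exp (lam * s) * ((E (u s)).toReal - (E (u t)).toReal) +
      (Real.exp (lam * t) - Real.exp (lam * s)) * ((E (w t)).toReal - (E (u t)).toReal)) := by ring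
    _ ≤ _ := h3
    _ ≤ _ := h4
    _ = _ := by ring

end Integrated

/-! ### The global slope. -/

/-- The descent of `E` from `x` is at most linear with rate `c`, up to the quadratic correction
of a `lam`-convex function. -/
def SlopeBound (E : X → EReal) (lam c : ℝ) (x : X) : Prop :=
  ∀ y, E x ≤ E y + ((c * dist x y - lam / 2 * dist x y ^ 2 : ℝ) : EReal)

/-- The global slope: the smallest rate in `SlopeBound`. -/
def globalSlope (E : X → EReal) (lam : ℝ) (x : X) : ℝ≥0∞ :=
  ⨅ (c : NNReal) (_ : SlopeBound E lam c x), (c : ℝ≥0∞)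

section Slope

variable {E : X → EReal} {lam : ℝ}

theorem SlopeBound.mono {c c' : ℝ} {x : X} (h : SlopeBound E lam c x) (hc : c ≤ c') :
    SlopeBound E lam c' x := fun y => by
  refine (h y).trans (add_le_add le_rfl ?_)
  rw [EReal.coe_le_coe_iff]
  gcongr

theorem SlopeBound.globalSlope_le {c : ℝ} {x : X} (h : SlopeBound E lam c x) (hc : 0 ≤ c) :
    globalSlope E lam x ≤ ENNReal.ofReal c := by
  refine iInf₂_le (c.toNNReal) ?_
  rwa [Real.coe_toNNReal c hc]

theorem slopeBound_of_globalSlope_lt {c : NNReal} {x : X} (h : globalSlope E lam x < c) :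
    SlopeBound E lam c x := by
  simp only [globalSlope, iInf_lt_iff] at h
  obtain ⟨c', hb, hlt⟩ := h
  exact hb.mono (by exact_mod_cast hlt.le)

theorem isClosed_slopeBound (hlsc : LowerSemicontinuous E) (hbot : ∀ x, E x ≠ ⊥) (c : ℝ) :
    IsClosed {x | SlopeBound E lam c x} := by
  simp only [SlopeBound, ofPred_forall]
  refine isClosed_iInter fun y => ?_
  have hcont : Continuous fun x : X =>
      E y + ((c * dist x y - lam / 2 * dist x y ^ 2 : ℝ) : EReal) := by
    rw [continuous_iff_continuousAt]
    intro x
    have h1 : ContinuousAt (fun x : X => ((c * dist x y - lam / 2 * dist x y ^ 2 : ℝ) : EReal)) x :=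
      (continuous_coe_real_ereal.comp (by fun_prop)).continuousAt
    exact ContinuousAt.comp (f := fun x : X => (E y, _)) (g := fun p : EReal × EReal => p.1 + p.2)
      (EReal.continuousAt_add (Or.inr (EReal.coe_ne_bot _)) (Or.inl (hbot y)))
      (continuousAt_const.prodMk h1)
  exact hlsc.isClosed_epigraph.preimage (continuous_id.prodMk hcont)

/-- A sublevel set is an intersection of sets cut out by inequalities between the lower
semicontinuous E and continuous functions of x. This is what lets the Fisher term pass to the limit
along Riemann sums. -/
theorem lowerSemicontinuous_globalSlope (hlsc : LowerSemicontinuous E) (hbot : ∀ x, E x ≠ ⊥) :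
    LowerSemicontinuous (globalSlope E lam) := by
  rw [lowerSemicontinuous_iff_isClosed_preimage]
  intro c
  induction c with
  | top => simp
  | coe c =>
    have : globalSlope E lam ⁻¹' Iic (c : ℝ≥0∞) =
        ⋂ (c' : NNReal) (_ : c < c'), {x | SlopeBound E lam c' x} := by
      ext x
      simp only [mem_preimage, mem_Iic, mem_iInter]
      constructor
      · intro h c' hc
        exact slopeBound_of_globalSlope_lt (lt_of_le_of_lt h (by exact_mod_cast hc))
      · intro h
        refine ENNReal.le_of_forall_pos_le_add fun ε hε _ => ?_
        have := SlopeBound.globalSlope_le (h (c + ε) (by simpa using hε)) (NNReal.coe_nonneg _)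
        simpa [← NNReal.coe_add, ENNReal.ofReal_coe_nnreal] using this
    rw [this]
    exact isClosed_biInter fun c' _ => isClosed_slopeBound hlsc hbot c'

theorem slope_le_globalSlope (hE : StandingAssumptions E lam) (x : X) :
    slope E x ≤ globalSlope E lam x := by
  refine le_iInf₂ fun c hc => ?_
  have htop : E x ≠ ⊤ := by
    -- A finite rate at x, tested against one point of the domain, puts x in the domain, so the
    -- slope is given by its limsup branch.
    obtain ⟨y, hy⟩ := hE.dense_domain.nonempty_iff.2 ⟨x⟩
    refine ne_top_of_le_ne_top ?_ (hc y)
    exact (EReal.add_lt_top hy (EReal.coe_ne_top _)).ne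
  rw [slope, if_neg htop]
  have hlim : Tendsto (fun y => ENNReal.ofReal (c + |lam| / 2 * dist x y)) (𝓝[≠] x)
      (𝓝 (c : ℝ≥0∞)) := by
    have h1 : Continuous fun y => ENNReal.ofReal (c + |lam| / 2 * dist x y) :=
      ENNReal.continuous_ofReal.comp (by fun_prop)
    have h2 := (h1.tendsto x).mono_left (nhdsWithin_le_nhds (s := {x}ᶜ))
    simpa using h2
  have hle : ∀ᶠ y in 𝓝[≠] x, (E x - E y).toENNReal / edist x y ≤
      ENNReal.ofReal (c + |lam| / 2 * dist x y) := by
    filter_upwards [self_mem_nhdsWithin] with y hy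
    have hd : 0 < dist x y := dist_pos.2 (Ne.symm hy)
    rw [ENNReal.div_le_iff (by simpa [edist_eq_zero] using Ne.symm hy) (edist_ne_top _ _),
      edist_dist, ← ENNReal.ofReal_mul (by positivity)]
    have hsub : E x - E y ≤ (((c + |lam| / 2 * dist x y) * dist x y : ℝ) : EReal) := by
      have h1 := hc y
      by_cases hy' : E y = ⊤
      · rw [hy', EReal.sub_top]; exact bot_le
      lift E y to ℝ using ⟨hy', hE.ne_bot y⟩ with Ey
      lift E x to ℝ using ⟨htop, hE.ne_bot x⟩ with Ex
      norm_cast at h1 ⊢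
      nlinarith [neg_abs_le lam, sq_nonneg (dist x y)]
    calc (E x - E y).toENNReal ≤ EReal.toENNReal _ := EReal.toENNReal_le_toENNReal hsub
      _ = _ := by rw [EReal.toENNReal_of_ne_top (EReal.coe_ne_top _), EReal.toReal_coe]
  by_cases hbot : 𝓝[≠] x = ⊥
  · rw [hbot, limsup_bot]; exact bot_le
  have : (𝓝[≠] x).NeBot := ⟨hbot⟩
  calc _ ≤ limsup (fun y => ENNReal.ofReal (c + |lam| / 2 * dist x y)) (𝓝[≠] x) :=
        limsup_le_limsup hle
    _ = c := hlim.limsup_eq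

end Slope

theorem hasDerivAt_nonpos_of_frequently_le {N : ℝ → ℝ} {n : ℝ} (h : HasDerivAt N n 0)
    (hf : ∃ᶠ τ in 𝓝[>] 0, N τ ≤ N 0) : n ≤ 0 := by
  by_contra hn
  push Not at hn
  have h1 := (hasDerivAt_iff_tendsto_slope.1 h).mono_left
    (nhdsWithin_mono 0 (fun τ (hτ : 0 < τ) => hτ.ne'))
  refine hf ?_
  filter_upwards [h1.eventually (lt_mem_nhds hn), self_mem_nhdsWithin] with τ hτ hpos
  rw [slope_def_field, sub_zero, div_pos_iff_of_pos_right hpos] at hτ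
  linarith

/-! ### Regularisation: the slope along a flow is controlled by the energy dissipation. -/

section Integrated

variable {E : X → EReal} {lam : ℝ} {u : ℝ → X}

/-- Speed bounds slope. In the EVI from s to s + τ tested against y, the distance to y is at least D
- cτ and the energy is eventually above any z < E(u s). The resulting function of τ is frequently at
most its value at 0, and the sign of its derivative there is the claim with z in place of E(u s). -/
theorem IntegratedEVI.slopeBound_of_frequently (h : IntegratedEVI E lam u)
    (hbot : ∀ x, E x ≠ ⊥) (hlsc : LowerSemicontinuous E) {s c : ℝ} (hs : 0 < s)
    (hf : ∃ᶠ τ in 𝓝[>] 0, dist (u (s + τ)) (u s) ≤ c * τ) : SlopeBound E lam c (u s) := by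
  intro y
  by_cases hy : E y = ⊤
  · rw [hy, EReal.top_add_coe]; exact le_top
  rcases (dist_nonneg (x := u s) (y := y)).eq_or_lt with h0 | hD
  · rw [dist_eq_zero.1 h0.symm]; simp
  set D := dist (u s) y with hDdef
  have hfin := h.energy_ne_top s hs
  rw [← EReal.coe_toReal hfin (hbot _), ← EReal.coe_toReal hy (hbot _), ← EReal.coe_add,
    EReal.coe_le_coe_iff]
  set Ey := (E y).toReal with hEy
  refine le_of_forall_lt_imp_le_of_dense fun z hz => ?_
  have hder : HasDerivAt (fun τ => (∫ r in s..(s + τ), Real.exp (lam * r)) * (z - Ey) +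
      Real.exp (lam * (s + τ)) / 2 * (D - c * τ) ^ 2)
      (Real.exp (lam * s) * (z - Ey) + (Real.exp (lam * s) * lam / 2 * D ^ 2 +
        Real.exp (lam * s) / 2 * (2 * D * (-c)))) 0 := by
    have hJ : HasDerivAt (fun τ => ∫ r in s..(s + τ), Real.exp (lam * r)) (Real.exp (lam * s)) 0 := by
      have hc : Continuous fun r => Real.exp (lam * r) := by fun_prop
      have := (hc.integral_hasStrictDerivAt s s).hasDerivAt
      rw [← add_zero s] at this
      simpa using HasDerivAt.comp_const_add s 0 (by simpa using this)
    have h1 : HasDerivAt (fun τ => Real.exp (lam * (s + τ)) / 2) (Real.exp (lam * s) * lam / 2) 0 := by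
      have := ((((hasDerivAt_id (0 : ℝ)).const_add s).const_mul lam).exp).div_const 2
      simpa using this
    have h2 : HasDerivAt (fun τ => (D - c * τ) ^ 2) (2 * D * (-c)) 0 := by
      have := (((hasDerivAt_id (0 : ℝ)).const_mul c).const_sub D).fun_pow 2
      simpa using this
    have := (hJ.mul_const (z - Ey)).fun_add (h1.fun_mul h2)
    simpa only [add_zero, mul_zero, sub_zero] using this
  have hcont : Tendsto (fun τ => u (s + τ)) (𝓝[>] 0) (𝓝 (u s)) := by
    have h1 : ContinuousAt u s := h.continuousOn.continuousAt (Ioi_mem_nhds hs)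
    have h2 : Tendsto (fun τ : ℝ => s + τ) (𝓝[>] 0) (𝓝 s) := by
      have : Continuous fun τ : ℝ => s + τ := by fun_prop
      simpa using (this.tendsto 0).mono_left nhdsWithin_le_nhds
    exact h1.tendsto.comp h2
  have hev1 : ∀ᶠ τ in 𝓝[>] (0 : ℝ), (z : EReal) < E (u (s + τ)) := by
    refine hcont.eventually (hlsc (u s) z ?_)
    change (z : EReal) < E (u s)
    rwa [← EReal.coe_toReal hfin (hbot _), EReal.coe_lt_coe_iff]
  have hev2 : ∀ᶠ τ in 𝓝[>] (0 : ℝ), 0 < D - c * τ := by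
    have : Continuous fun τ : ℝ => D - c * τ := by fun_prop
    have := (this.tendsto 0).mono_left (nhdsWithin_le_nhds (s := Ioi 0))
    exact this.eventually (lt_mem_nhds (by simpa using hD))
  have hle := hasDerivAt_nonpos_of_frequently_le hder ?_
  · have hp := Real.exp_pos (lam * s)
    have : Real.exp (lam * s) * (z - Ey + lam / 2 * D ^ 2 - c * D) ≤ 0 := by linarith
    have := nonpos_of_mul_nonpos_right this hp
    linarith
  refine (hf.and_eventually ((hev1.and hev2).and self_mem_nhdsWithin)).mono ?_
  rintro τ ⟨hτ, ⟨hz', hpos⟩, hτ0⟩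
  have hτ0 : 0 < τ := hτ0
  have hevi := h.evi_endpoint hs (by linarith : s ≤ s + τ) hy
  have hz2 : z ≤ (E (u (s + τ))).toReal := by
    have := EReal.coe_toReal (h.energy_ne_top (s + τ) (by linarith)) (hbot _)
    rw [← this, EReal.coe_lt_coe_iff] at hz'
    exact hz'.le
  have hJ0 : 0 ≤ ∫ r in s..(s + τ), Real.exp (lam * r) :=
    intervalIntegral.integral_nonneg (by linarith) fun r _ => (Real.exp_pos _).le
  have htri : D - c * τ ≤ dist (u (s + τ)) y := by
    have := dist_triangle (u s) (u (s + τ)) y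
    rw [dist_comm (u s) (u (s + τ))] at this
    linarith
  have hsq : (D - c * τ) ^ 2 ≤ dist (u (s + τ)) y ^ 2 := by gcongr
  have h1 := mul_le_mul_of_nonneg_left hsq (half_pos (Real.exp_pos (lam * (s + τ)))).le
  have h2 := mul_le_mul_of_nonneg_left (sub_le_sub_left hz2 Ey) hJ0
  simp only [add_zero, intervalIntegral.integral_same, zero_mul, mul_zero, sub_zero, zero_add]
  linarith

/-- Testing the EVI against u s bounds the squared distance travelled by the integral of the energy
drop, which is of order -d τ²/2 on each side of the factor ½. -/
theorem IntegratedEVI.eventually_dist_le (h : IntegratedEVI E lam u) {s c d : ℝ} (hs : 0 < s)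
    (hc : 0 < c) (hd : HasDerivAt (fun t => (E (u t)).toReal) d s) (hcd : -d < c ^ 2) :
    ∀ᶠ τ in 𝓝[>] 0, dist (u (s + τ)) (u s) ≤ c * τ := by
  set e : ℝ → ℝ := fun t => (E (u t)).toReal with he
  -- The gap between `p` and c² absorbs the exponential weights for small τ.
  obtain ⟨p, hp1, hp2⟩ := exists_between (max_lt hcd (by positivity : 0 < c ^ 2))
  rw [max_lt_iff] at hp1
  obtain ⟨hp1, hp0⟩ := hp1
  have hslope := (hasDerivAt_iff_tendsto_slope.1 hd).mono_left
    (nhdsWithin_mono s (fun r (hr : s < r) => hr.ne'))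
  have hev : ∀ᶠ r in 𝓝[>] s, e s - e r ≤ p * (r - s) := by
    filter_upwards [hslope.eventually (lt_mem_nhds (by linarith : -p < d)), self_mem_nhdsWithin]
      with r hr hrs
    have hrs : 0 < r - s := sub_pos.2 hrs
    rw [slope_def_field, lt_div_iff₀ hrs] at hr
    linarith
  obtain ⟨δ, hδ, hsub⟩ := mem_nhdsGT_iff_exists_Ioo_subset.1 hev
  have hδ : s < δ := hδ
  have hev2 : ∀ᶠ τ in 𝓝[>] (0 : ℝ), Real.exp (2 * |lam| * τ) * p < c ^ 2 := by
    have : Continuous fun τ : ℝ => Real.exp (2 * |lam| * τ) * p := by fun_prop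
    have := (this.tendsto 0).mono_left (nhdsWithin_le_nhds (s := Ioi 0))
    exact this.eventually (gt_mem_nhds (by simpa using hp2))
  have hev3 : ∀ᶠ τ in 𝓝[>] (0 : ℝ), τ < δ - s :=
    nhdsWithin_le_nhds (gt_mem_nhds (by linarith))
  filter_upwards [hev2, hev3, self_mem_nhdsWithin] with τ h2 h3 hτ
  have hτ : 0 < τ := hτ
  have hevi := h.evi s (s + τ) (u s) hs (by linarith) (h.energy_ne_top s hs)
  rw [dist_self] at hevi
  have hint : ∫ r in s..(s + τ), Real.exp (lam * r) * (e s - e r) ≤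
      ∫ r in s..(s + τ), Real.exp (lam * s + |lam| * τ) * (p * (r - s)) := by
    refine intervalIntegral.integral_mono_on (by linarith)
      (intervalIntegrable_exp_mul_sub h.antitoneOn _ hs (by linarith))
      (Continuous.intervalIntegrable (by fun_prop) _ _) fun r hr => ?_
    rcases hr.1.eq_or_lt with rfl | hlt
    · simp
    have hr1 : e s - e r ≤ p * (r - s) := hsub ⟨hlt, by linarith [hr.2]⟩
    have hr2 : Real.exp (lam * r) ≤ Real.exp (lam * s + |lam| * τ) := by
      apply Real.exp_le_exp.2
      have : lam * (r - s) ≤ |lam| * (r - s) := by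
        gcongr; exact le_abs_self _
      have : |lam| * (r - s) ≤ |lam| * τ := by gcongr; linarith [hr.2]
      linarith
    have hr0 : 0 ≤ p * (r - s) := mul_nonneg hp0.le (by linarith)
    exact (mul_le_mul_of_nonneg_left hr1 (Real.exp_pos _).le).trans
      (mul_le_mul_of_nonneg_right hr2 hr0)
  have hval : ∫ r in s..(s + τ), Real.exp (lam * s + |lam| * τ) * (p * (r - s)) =
      Real.exp (lam * s + |lam| * τ) * (p * (τ ^ 2 / 2)) := by
    rw [intervalIntegral.integral_const_mul, intervalIntegral.integral_const_mul,
      intervalIntegral.integral_comp_sub_right (fun r => r)]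
    simp
  rw [hval] at hint
  have hmain : Real.exp (lam * (s + τ)) / 2 * dist (u (s + τ)) (u s) ^ 2 ≤
      Real.exp (lam * s + |lam| * τ) * (p * (τ ^ 2 / 2)) := by
    have := hevi.trans hint
    simpa using this
  have hexp : Real.exp (lam * s + |lam| * τ) ≤
      Real.exp (lam * (s + τ)) * Real.exp (2 * |lam| * τ) := by
    rw [← Real.exp_add]
    apply Real.exp_le_exp.2
    have : -|lam| * τ ≤ lam * τ := by gcongr; exact neg_abs_le _
    linarith
  have h5 : Real.exp (lam * (s + τ)) * dist (u (s + τ)) (u s) ^ 2 ≤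
      Real.exp (lam * (s + τ)) * (c * τ) ^ 2 := by
    have h6 : Real.exp (lam * s + |lam| * τ) * (p * τ ^ 2) ≤
        Real.exp (lam * (s + τ)) * Real.exp (2 * |lam| * τ) * (p * τ ^ 2) := by gcongr
    have h7 : Real.exp (lam * (s + τ)) * τ ^ 2 * (Real.exp (2 * |lam| * τ) * p) ≤
        Real.exp (lam * (s + τ)) * τ ^ 2 * c ^ 2 := by gcongr
    linarith
  have h8 := le_of_mul_le_mul_left h5 (Real.exp_pos _)
  exact le_of_sq_le_sq h8 (by positivity)

/-- The shifted curve is again a flow, so contraction transports the speed bound from `s` to `t`,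
where it becomes a slope bound. Differentiability of the energy is thus needed at `s` only. -/
theorem IntegratedEVI.globalSlope_sq_le (h : IntegratedEVI E lam u) (hbot : ∀ x, E x ≠ ⊥)
    (hlsc : LowerSemicontinuous E) {s t d : ℝ} (hs : 0 < s) (hst : s ≤ t)
    (hd : HasDerivAt (fun t => (E (u t)).toReal) d s) :
    globalSlope E lam (u t) ≠ ⊤ ∧
      (Real.exp (lam * (t - s)) * (globalSlope E lam (u t)).toReal) ^ 2 ≤ -d := by
  have hbound : ∀ c, 0 < c → -d < c ^ 2 →
      globalSlope E lam (u t) ≤ ENNReal.ofReal (Real.exp (lam * (s - t)) * c) := by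
    intro c hc hcd
    refine SlopeBound.globalSlope_le ?_ (by positivity)
    refine h.slopeBound_of_frequently hbot hlsc (hs.trans_le hst) (Eventually.frequently ?_)
    filter_upwards [h.eventually_dist_le hs hc hd hcd, self_mem_nhdsWithin] with τ hτ hτ0
    have hcon := (h.shift (le_of_lt hτ0)).contraction h hs hst
    have hexp : Real.exp (lam * (s - t)) = Real.exp (lam * s) / Real.exp (lam * t) := by
      rw [← Real.exp_sub]; ring_nf
    have hpt := Real.exp_pos (lam * t)
    have hps := Real.exp_pos (lam * s)
    rw [hexp, div_mul_eq_mul_div, div_mul_eq_mul_div, le_div_iff₀ hpt]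
    have := mul_le_mul_of_nonneg_left hτ hps.le
    linarith
  have hne : globalSlope E lam (u t) ≠ ⊤ := by
    have hsq : -d < (|d| + 1) ^ 2 := by nlinarith [neg_abs_le d, abs_nonneg d]
    exact ne_top_of_le_ne_top ENNReal.ofReal_ne_top (hbound (|d| + 1) (by positivity) hsq)
  refine ⟨hne, ?_⟩
  have hd0 : d ≤ 0 := by
    have h1 : derivWithin (fun t => (E (u t)).toReal) (Ioi 0) s ≤ 0 := h.antitoneOn.derivWithin_nonpos
    rwa [derivWithin_of_mem_nhds (Ioi_mem_nhds hs), hd.deriv] at h1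
  by_contra hcon
  push Not at hcon
  set ℓ := (globalSlope E lam (u t)).toReal with hℓ
  set x := Real.exp (lam * (t - s)) * ℓ with hx
  have hx0 : 0 ≤ x := by positivity
  have hlt : Real.sqrt (-d) < x := (Real.sqrt_lt (by linarith) hx0).2 hcon
  obtain ⟨c, hc1, hc2⟩ := exists_between hlt
  have hc0 : 0 < c := lt_of_le_of_lt (Real.sqrt_nonneg _) hc1
  have hb := hbound c hc0 ((Real.sqrt_lt' hc0).1 hc1)
  have hb' : ℓ ≤ Real.exp (lam * (s - t)) * c := ENNReal.toReal_le_of_le_ofReal (by positivity) hb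
  have hx' : x ≤ c := by
    have := mul_le_mul_of_nonneg_left hb' (Real.exp_pos (lam * (t - s))).le
    rw [← mul_assoc, ← Real.exp_add] at this
    have e0 : lam * (t - s) + lam * (s - t) = 0 := by ring
    rw [e0, Real.exp_zero, one_mul] at this
    exact this
  linarith

/-- The previous bound is integrated over the starting time. For a monotone function the integral of
the derivative is at most the increment, so absolute continuity of the energy is not required. -/
theorem IntegratedEVI.globalSlope_sq_mul_le (h : IntegratedEVI E lam u) (hbot : ∀ x, E x ≠ ⊥)
    (hlsc : LowerSemicontinuous E) {s t : ℝ} (hs : 0 < s) (hst : s ≤ t) :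
    (globalSlope E lam (u t)).toReal ^ 2 * Real.exp (-(2 * |lam| * (t - s))) * (t - s) ≤
      (E (u s)).toReal - (E (u t)).toReal := by
  set e : ℝ → ℝ := fun t => (E (u t)).toReal with he
  set ℓ := (globalSlope E lam (u t)).toReal with hℓ
  have hmono : MonotoneOn (fun t => -e t) (Ioi 0) := h.antitoneOn.neg
  have hsub : uIcc s t ⊆ Ioi 0 := by
    rw [uIcc_of_le hst]; exact fun r hr => lt_of_lt_of_le hs hr.1
  have hmem := (hmono.mono hsub).intervalIntegral_deriv_mem_uIcc
  have hle0 : 0 ≤ -e t - -e s := by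
    have := h.antitoneOn hs (hs.trans_le hst) hst
    simp only at this
    simp only [he]; linarith
  rw [uIcc_of_le hle0] at hmem
  have hint : ∫ r in s..t, ℓ ^ 2 * Real.exp (-(2 * |lam| * (t - s))) ≤
      ∫ r in s..t, deriv (fun t => -e t) r := by
    refine intervalIntegral.integral_mono_ae_restrict hst intervalIntegrable_const
      (hmono.mono hsub).intervalIntegrable_deriv ?_
    rw [EventuallyLE, ae_restrict_iff' measurableSet_Icc]
    filter_upwards [hmono.ae_differentiableWithinAt_of_mem] with r hr hrs
    have hr0 : 0 < r := lt_of_lt_of_le hs hrs.1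
    have hdiff := (hr hr0).differentiableAt (Ioi_mem_nhds hr0)
    have hd : HasDerivAt e (-(deriv (fun t => -e t) r)) r := by
      simpa only [neg_neg] using hdiff.hasDerivAt.fun_neg
    have hb := (h.globalSlope_sq_le hbot hlsc hr0 hrs.2 hd).2
    rw [neg_neg] at hb
    refine le_trans ?_ hb
    rw [mul_pow, mul_comm, ← Real.exp_nat_mul]
    refine mul_le_mul_of_nonneg_right (Real.exp_le_exp.2 ?_) (sq_nonneg _)
    have h1 : -|lam| * (t - r) ≤ lam * (t - r) := by
      gcongr
      exacts [by linarith [hrs.2], neg_abs_le _]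
    have h2 : |lam| * (t - r) ≤ |lam| * (t - s) := by gcongr; exact hrs.1
    push_cast
    linarith
  rw [intervalIntegral.integral_const, smul_eq_mul] at hint
  have := hint.trans hmem.2
  linarith

theorem IntegratedEVI.globalSlope_ne_top (h : IntegratedEVI E lam u) (hbot : ∀ x, E x ≠ ⊥)
    (hlsc : LowerSemicontinuous E) {t : ℝ} (ht : 0 < t) : globalSlope E lam (u t) ≠ ⊤ := by
  have hmono : MonotoneOn (fun t => -(E (u t)).toReal) (Ioi 0) := h.antitoneOn.neg
  by_contra hcon
  have h0 : volume (Ioc 0 t) = 0 := by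
    refine measure_mono_null ?_ (ae_iff.1 hmono.ae_differentiableWithinAt_of_mem)
    intro r hr
    simp only [mem_ofPred_eq]
    intro hd
    have hdiff := ((hd hr.1).differentiableAt (Ioi_mem_nhds hr.1)).hasDerivAt.fun_neg
    exact (h.globalSlope_sq_le hbot hlsc hr.1 hr.2 (by simpa only [neg_neg] using hdiff)).1 hcon
  simp at h0
  linarith

/-- The integrated evolution variational inequality with the dissipation of the energy kept. -/
theorem IntegratedEVI.evi_globalSlope (h : IntegratedEVI E lam u) (hbot : ∀ x, E x ≠ ⊥)
    (hlsc : LowerSemicontinuous E) {s t : ℝ} {y : X} (hs : 0 < s) (hst : s ≤ t) (hy : E y ≠ ⊤) :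
    Real.exp (lam * t) / 2 * dist (u t) y ^ 2 - Real.exp (lam * s) / 2 * dist (u s) y ^ 2 ≤
      (∫ r in s..t, Real.exp (lam * r)) * ((E y).toReal - (E (u t)).toReal) -
      Real.exp (lam * s) * Real.exp (-(3 * |lam| * (t - s))) *
        (globalSlope E lam (u t)).toReal ^ 2 * ((t - s) ^ 2 / 2) := by
  set ℓ := (globalSlope E lam (u t)).toReal with hℓ
  set K := Real.exp (lam * s) * Real.exp (-(3 * |lam| * (t - s))) * ℓ ^ 2 with hK
  refine (h.evi s t y hs hst hy).trans ?_
  -- At time r the energy exceeds its value at `t` by a multiple of t - r; integrating this excess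
  -- produces (t - s)²/2.
  have hval : ∫ r in s..t, (Real.exp (lam * r) * ((E y).toReal - (E (u t)).toReal) -
      K * (t - r)) = (∫ r in s..t, Real.exp (lam * r)) * ((E y).toReal - (E (u t)).toReal) -
      K * ((t - s) ^ 2 / 2) := by
    rw [intervalIntegral.integral_sub (Continuous.intervalIntegrable (by fun_prop) _ _)
      (Continuous.intervalIntegrable (by fun_prop) _ _), intervalIntegral.integral_mul_const,
      intervalIntegral.integral_const_mul, intervalIntegral.integral_comp_sub_left (fun r => r)]
    simp
  rw [← hval]
  refine intervalIntegral.integral_mono_on hst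
    (intervalIntegrable_exp_mul_sub h.antitoneOn _ hs hst)
    (Continuous.intervalIntegrable (by fun_prop) _ _) fun r hr => ?_
  have hr0 : 0 < r := lt_of_lt_of_le hs hr.1
  have htr : 0 ≤ t - r := by linarith [hr.2]
  have hg := h.globalSlope_sq_mul_le hbot hlsc hr0 hr.2
  have h1 : K * (t - r) ≤ Real.exp (lam * r) *
      (ℓ ^ 2 * Real.exp (-(2 * |lam| * (t - r))) * (t - r)) := by
    have h2 : Real.exp (lam * s) * Real.exp (-(3 * |lam| * (t - s))) ≤
        Real.exp (lam * r) * Real.exp (-(2 * |lam| * (t - r))) := by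
      rw [← Real.exp_add, ← Real.exp_add]
      apply Real.exp_le_exp.2
      have h3 : -|lam| * (r - s) ≤ lam * (r - s) := by
        gcongr
        exacts [by linarith [hr.1], neg_abs_le _]
      have h4 : |lam| * (r - s) ≤ |lam| * (t - s) := by gcongr; exact hr.2
      have h5 : |lam| * (t - r) ≤ |lam| * (t - s) := by gcongr; exact hr.1
      linarith
    have h6 := mul_le_mul_of_nonneg_right h2 (by positivity : 0 ≤ ℓ ^ 2 * (t - r))
    linarith
  have h7 := mul_le_mul_of_nonneg_left hg (Real.exp_pos (lam * r)).le
  linarith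

end Integrated

/-! ### The semigroup and the comparison estimate. -/

section Semigroup

variable {E : X → EReal} {lam : ℝ}

theorem semigroup_zero (x : X) : semigroup E lam 0 x = x := by
  simp [semigroup]

/-- All positive times are read off from one chosen flow, so neither uniqueness nor the semigroup
law enters. -/
theorem exists_flow_eq_semigroup (hE : StandingAssumptions E lam) (x : X) :
    ∃ u : ℝ → X, IsEVIFlowFrom E lam x u ∧ ∀ t, 0 < t → semigroup E lam t x = u t := by
  refine ⟨(hE.exists_flow x).choose, (hE.exists_flow x).choose_spec, fun t ht => ?_⟩
  rw [semigroup, dif_pos ⟨ht, hE.exists_flow x⟩]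

theorem energy_semigroup_ne_top (hE : StandingAssumptions E lam) (x : X) {t : ℝ} (ht : 0 < t) :
    E (semigroup E lam t x) ≠ ⊤ := by
  obtain ⟨u, hu, hS⟩ := exists_flow_eq_semigroup hE x
  rw [hS t ht]
  exact hu.energy_ne_top hE ht

theorem globalSlope_semigroup_ne_top (hE : StandingAssumptions E lam) (x : X) {t : ℝ}
    (ht : 0 < t) : globalSlope E lam (semigroup E lam t x) ≠ ⊤ := by
  obtain ⟨u, hu, hS⟩ := exists_flow_eq_semigroup hE x
  rw [hS t ht]
  exact (hu.integratedEVI hE).globalSlope_ne_top hE.ne_bot hE.lsc ht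

theorem tendsto_semigroup_nhdsGT_zero (hE : StandingAssumptions E lam) (x : X) :
    Tendsto (fun t => semigroup E lam t x) (𝓝[>] 0) (𝓝 x) := by
  obtain ⟨u, hu, hS⟩ := exists_flow_eq_semigroup hE x
  refine hu.tendsto_start.congr' ?_
  filter_upwards [self_mem_nhdsWithin] with t ht using (hS t ht).symm

theorem continuousOn_semigroup (hE : StandingAssumptions E lam) (x : X) :
    ContinuousOn (fun t => semigroup E lam t x) (Ici 0) := by
  obtain ⟨u, hu, hS⟩ := exists_flow_eq_semigroup hE x
  intro t ht
  rcases (show 0 ≤ t from ht).eq_or_lt with rfl | hpos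
  · rw [← Ioi_insert, continuousWithinAt_insert_self, ContinuousWithinAt, semigroup_zero]
    exact tendsto_semigroup_nhdsGT_zero hE x
  · have h1 : ContinuousAt u t :=
      (hu.integratedEVI hE).continuousOn.continuousAt (Ioi_mem_nhds hpos)
    refine (h1.congr ?_).continuousWithinAt
    filter_upwards [Ioi_mem_nhds hpos] with r hr using (hS r hr).symm

theorem semigroup_contraction (hE : StandingAssumptions E lam) (x y : X) {t : ℝ} (ht : 0 ≤ t) :
    Real.exp (lam * t) * dist (semigroup E lam t x) (semigroup E lam t y) ≤ dist x y := by
  rcases ht.eq_or_lt with rfl | hpos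
  · simp [semigroup_zero]
  obtain ⟨u, hu, hSu⟩ := exists_flow_eq_semigroup hE x
  obtain ⟨w, hw, hSw⟩ := exists_flow_eq_semigroup hE y
  rw [hSu t hpos, hSw t hpos]
  have hexp : Tendsto (fun a => Real.exp (lam * a)) (𝓝[>] 0) (𝓝 1) := by
    have : Continuous fun a => Real.exp (lam * a) := by fun_prop
    simpa using (this.tendsto 0).mono_left (nhdsWithin_le_nhds (s := Ioi 0))
  have hlim := hexp.mul (hu.tendsto_start.dist hw.tendsto_start)
  rw [one_mul] at hlim
  refine ge_of_tendsto hlim ?_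
  filter_upwards [Ioo_mem_nhdsGT hpos] with a ha
  exact (hu.integratedEVI hE).contraction (hw.integratedEVI hE) ha.1 ha.2.le

theorem dist_semigroup_le (hE : StandingAssumptions E lam) (x y : X) {t : ℝ} (ht : 0 ≤ t) :
    dist (semigroup E lam t x) (semigroup E lam t y) ≤ Real.exp (|lam| * t) * dist x y := by
  have h := semigroup_contraction hE x y ht
  have h1 : Real.exp (|lam| * t) * Real.exp (lam * t) ≥ 1 := by
    rw [← Real.exp_add, ge_iff_le, Real.one_le_exp_iff]
    have : -|lam| * t ≤ lam * t := by gcongr; exact neg_abs_le _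
    linarith
  calc dist (semigroup E lam t x) (semigroup E lam t y)
      ≤ Real.exp (|lam| * t) * Real.exp (lam * t) *
        dist (semigroup E lam t x) (semigroup E lam t y) := le_mul_of_one_le_left dist_nonneg h1
    _ ≤ _ := by rw [mul_assoc]; gcongr

theorem continuousOn_uncurry_semigroup (hE : StandingAssumptions E lam) :
    ContinuousOn (fun p : ℝ × X => semigroup E lam p.1 p.2) (Ici 0 ×ˢ univ) := by
  rintro ⟨t, x⟩ ⟨ht, -⟩
  have h1 : Tendsto (fun p : ℝ × X => semigroup E lam p.1 x) (𝓝[Ici 0 ×ˢ univ] (t, x))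
      (𝓝 (semigroup E lam t x)) := by
    refine (continuousOn_semigroup hE x t ht).tendsto.comp ?_
    refine tendsto_nhdsWithin_iff.2 ⟨?_, ?_⟩
    · exact (continuous_fst.tendsto (t, x)).mono_left nhdsWithin_le_nhds
    · filter_upwards [self_mem_nhdsWithin] with p hp using hp.1
  have h2 : Tendsto (fun p : ℝ × X => Real.exp (|lam| * p.1) * dist p.2 x)
      (𝓝[Ici 0 ×ˢ univ] (t, x)) (𝓝 0) := by
    have : Continuous fun p : ℝ × X => Real.exp (|lam| * p.1) * dist p.2 x := by fun_prop
    simpa using (this.tendsto (t, x)).mono_left (nhdsWithin_le_nhds (s := Ici 0 ×ˢ univ))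
  refine tendsto_iff_dist_tendsto_zero.2 ?_
  have h3 := h2.add (tendsto_iff_dist_tendsto_zero.1 h1)
  rw [add_zero] at h3
  refine squeeze_zero' (Eventually.of_forall fun _ => dist_nonneg) ?_ h3
  filter_upwards [self_mem_nhdsWithin] with p hp
  exact (dist_triangle _ (semigroup E lam p.1 x) _).trans
    (add_le_add (dist_semigroup_le hE _ _ hp.1) le_rfl)

theorem integral_exp_mul_eq (lam s t : ℝ) :
    ∫ r in s..t, Real.exp (lam * r) =
      Real.exp (lam * s) * ∫ r in (0 : ℝ)..(t - s), Real.exp (lam * r) := by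
  rw [← intervalIntegral.integral_const_mul]
  have := intervalIntegral.integral_comp_add_right (fun r => Real.exp (lam * r)) s
    (a := 0) (b := t - s)
  rw [zero_add, sub_add_cancel] at this
  rw [← this]
  congr 1
  ext r
  rw [← Real.exp_add]
  ring_nf

theorem semigroup_evi_of_pos (hE : StandingAssumptions E lam) (x y : X) {s t : ℝ} (hs : 0 < s)
    (hst : s ≤ t) (hy : E y ≠ ⊤) :
    Real.exp (lam * (t - s)) / 2 * dist (semigroup E lam t x) y ^ 2 +
      Real.exp (-(3 * |lam| * (t - s))) *
        (globalSlope E lam (semigroup E lam t x)).toReal ^ 2 * ((t - s) ^ 2 / 2) +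
      (∫ r in (0 : ℝ)..(t - s), Real.exp (lam * r)) *
        ((E (semigroup E lam t x)).toReal - (E y).toReal) ≤
      dist (semigroup E lam s x) y ^ 2 / 2 := by
  obtain ⟨u, hu, hS⟩ := exists_flow_eq_semigroup hE x
  rw [hS t (hs.trans_le hst), hS s hs]
  have h := (hu.integratedEVI hE).evi_globalSlope hE.ne_bot hE.lsc hs hst hy
  rw [integral_exp_mul_eq] at h
  have hexp : Real.exp (lam * t) = Real.exp (lam * s) * Real.exp (lam * (t - s)) := by
    rw [← Real.exp_add]; ring_nf
  rw [hexp] at h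
  refine le_of_mul_le_mul_left ?_ (Real.exp_pos (lam * s))
  linarith

/-- The starting point enters only through its distance to y, so s ↓ 0 is harmless even when E(x) =
+∞. -/
theorem semigroup_evi (hE : StandingAssumptions E lam) (x y : X) {s t : ℝ} (hs : 0 ≤ s)
    (hst : s < t) (hy : E y ≠ ⊤) :
    Real.exp (lam * (t - s)) / 2 * dist (semigroup E lam t x) y ^ 2 +
      Real.exp (-(3 * |lam| * (t - s))) *
        (globalSlope E lam (semigroup E lam t x)).toReal ^ 2 * ((t - s) ^ 2 / 2) +
      (∫ r in (0 : ℝ)..(t - s), Real.exp (lam * r)) *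
        ((E (semigroup E lam t x)).toReal - (E y).toReal) ≤
      dist (semigroup E lam s x) y ^ 2 / 2 := by
  rcases hs.eq_or_lt with rfl | hpos
  swap
  · exact semigroup_evi_of_pos hE x y hpos hst.le hy
  have hcont : Continuous fun s => Real.exp (lam * (t - s)) / 2 * dist (semigroup E lam t x) y ^ 2 +
      Real.exp (-(3 * |lam| * (t - s))) *
        (globalSlope E lam (semigroup E lam t x)).toReal ^ 2 * ((t - s) ^ 2 / 2) +
      (∫ r in (0 : ℝ)..(t - s), Real.exp (lam * r)) *
        ((E (semigroup E lam t x)).toReal - (E y).toReal) := by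
    have hJ : Continuous fun b => ∫ r in (0 : ℝ)..b, Real.exp (lam * r) :=
      intervalIntegral.continuous_primitive
        (fun a b => Continuous.intervalIntegrable (by fun_prop) _ _) 0
    have hJ' : Continuous fun s => ∫ r in (0 : ℝ)..(t - s), Real.exp (lam * r) :=
      hJ.comp (by fun_prop : Continuous fun s => t - s)
    fun_prop
  have hl := (hcont.tendsto 0).mono_left (nhdsWithin_le_nhds (s := Ioi 0))
  have hr : Tendsto (fun s => dist (semigroup E lam s x) y ^ 2 / 2) (𝓝[>] 0)
      (𝓝 (dist (semigroup E lam 0 x) y ^ 2 / 2)) := by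
    rw [semigroup_zero]
    exact (((tendsto_semigroup_nhdsGT_zero hE x).dist tendsto_const_nhds).pow 2).div_const 2
  refine le_of_tendsto_of_tendsto hl hr ?_
  filter_upwards [Ioo_mem_nhdsGT hst] with s hs
  exact semigroup_evi_of_pos hE x y hs.1 hs.2.le hy

/-- Comparison of the flow from `p` at time `h + δ` with the flow from `q` at time `h`. -/
theorem semigroup_comparison (hE : StandingAssumptions E lam) (p q : X) {h δ : ℝ} (hh : 0 ≤ h)
    (hδ : 0 < δ) (hq : E (semigroup E lam h q) ≠ ⊤) :
    Real.exp (lam * δ) / 2 * dist (semigroup E lam (h + δ) p) (semigroup E lam h q) ^ 2 +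
      Real.exp (-(3 * |lam| * δ)) *
        (globalSlope E lam (semigroup E lam (h + δ) p)).toReal ^ 2 * (δ ^ 2 / 2) +
      (∫ r in (0 : ℝ)..δ, Real.exp (lam * r)) *
        ((E (semigroup E lam (h + δ) p)).toReal - (E (semigroup E lam h q)).toReal) ≤
      Real.exp (2 * |lam| * h) * dist p q ^ 2 / 2 := by
  have h1 := semigroup_evi hE p (semigroup E lam h q) hh (by linarith : h < h + δ) hq
  rw [add_sub_cancel_left] at h1
  refine h1.trans ?_
  have h2 := dist_semigroup_le hE p q hh
  have h3 : dist (semigroup E lam h p) (semigroup E lam h q) ^ 2 ≤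
      (Real.exp (|lam| * h) * dist p q) ^ 2 := by gcongr
  rw [mul_pow, ← Real.exp_nat_mul] at h3
  have e : ((2 : ℕ) : ℝ) * (|lam| * h) = 2 * |lam| * h := by push_cast; ring
  rw [e] at h3
  linarith

end Semigroup

/-! ### Metric speed, discrete energies and the kinetic energy. -/

theorem enorm_deriv_dist_le_metricSpeed (f : ℝ → X) (y : X) (t : ℝ) :
    ‖deriv (fun s => dist (f s) y) t‖ₑ ≤ metricSpeed f t := by
  by_cases hd : DifferentiableAt ℝ (fun s => dist (f s) y) t
  swap
  · rw [deriv_zero_of_not_differentiableAt hd]; simp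
  have h1 := (hasDerivAt_iff_tendsto_slope.1 hd.hasDerivAt).enorm
  rw [← h1.limsup_eq]
  refine limsup_le_limsup ?_
  filter_upwards [self_mem_nhdsWithin] with s hs
  have hs0 : s - t ≠ 0 := sub_ne_zero.2 hs
  rw [slope_def_field, div_eq_mul_inv, enorm_mul, enorm_inv hs0, ← div_eq_mul_inv,
    ← edist_eq_enorm_sub, ← edist_eq_enorm_sub]
  gcongr
  rw [edist_dist, edist_dist]
  exact ENNReal.ofReal_le_ofReal (dist_dist_dist_le_left _ _ _)

theorem ofReal_dist_sq_div_le_lintegral {f : ℝ → X} {s t : ℝ} (hst : s < t)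
    (hf : AbsolutelyContinuousOnInterval f s t) :
    ENNReal.ofReal (dist (f s) (f t) ^ 2 / (t - s)) ≤ ∫⁻ r in Ioc s t, metricSpeed f r ^ 2 := by
  set g : ℝ → ℝ := fun r => dist (f r) (f s) with hg
  have hgac := absolutelyContinuousOnInterval_dist hf (f s)
  have hftc := hgac.integral_deriv_eq_sub
  have hts : 0 < t - s := sub_pos.2 hst
  set d := dist (f s) (f t) with hd
  have hd0 : 0 ≤ d := dist_nonneg
  set a := d / (t - s) with ha
  have ha0 : 0 ≤ a := by positivity
  have hdle : ENNReal.ofReal d ≤ ∫⁻ r in Ioc s t, ‖deriv g r‖ₑ := by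
    have e1 : d = ∫ r in s..t, deriv g r := by
      rw [hftc]; simp [hd, dist_comm]
    rw [intervalIntegral.integral_of_le hst.le] at e1
    calc ENNReal.ofReal d = ‖∫ r in Ioc s t, deriv g r‖ₑ := by
          rw [← e1, Real.enorm_eq_ofReal hd0]
      _ ≤ _ := enorm_integral_le_lintegral_enorm _
  -- Cauchy–Schwarz in the form of Young's inequality with `a` the mean speed. Integrating it needs
  -- no measurability of `metricSpeed`; one of two copies of a·d then cancels.
  have hyoung : ∀ r, 2 * ENNReal.ofReal a * ‖deriv g r‖ₑ ≤
      metricSpeed f r ^ 2 + ENNReal.ofReal (a ^ 2) := by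
    intro r
    have h1 : 2 * ENNReal.ofReal a * ‖deriv g r‖ₑ ≤ ‖deriv g r‖ₑ ^ 2 + ENNReal.ofReal (a ^ 2) := by
      rw [Real.enorm_eq_ofReal_abs, ← ENNReal.ofReal_pow (abs_nonneg _),
        ← ENNReal.ofReal_add (by positivity) (by positivity),
        show (2 : ℝ≥0∞) = ENNReal.ofReal 2 by simp, ← ENNReal.ofReal_mul (by norm_num),
        ← ENNReal.ofReal_mul (by positivity)]
      apply ENNReal.ofReal_le_ofReal
      nlinarith [sq_nonneg (|deriv g r| - a)]
    refine h1.trans ?_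
    gcongr
    exact enorm_deriv_dist_le_metricSpeed f (f s) r
  have hint : ENNReal.ofReal (a * d) + ENNReal.ofReal (a * d) ≤
      (∫⁻ r in Ioc s t, metricSpeed f r ^ 2) + ENNReal.ofReal (a * d) := by
    calc ENNReal.ofReal (a * d) + ENNReal.ofReal (a * d)
        = 2 * ENNReal.ofReal a * ENNReal.ofReal d := by
          rw [ENNReal.ofReal_mul ha0]; ring
      _ ≤ 2 * ENNReal.ofReal a * ∫⁻ r in Ioc s t, ‖deriv g r‖ₑ := by gcongr
      _ = ∫⁻ r in Ioc s t, 2 * ENNReal.ofReal a * ‖deriv g r‖ₑ := by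
          rw [lintegral_const_mul _ (measurable_deriv g).enorm]
      _ ≤ ∫⁻ r in Ioc s t, (metricSpeed f r ^ 2 + ENNReal.ofReal (a ^ 2)) :=
          lintegral_mono fun r => hyoung r
      _ = (∫⁻ r in Ioc s t, metricSpeed f r ^ 2) + ENNReal.ofReal (a ^ 2) *
            ENNReal.ofReal (t - s) := by
          rw [lintegral_add_right _ measurable_const]; simp
      _ = _ := by
          rw [← ENNReal.ofReal_mul (by positivity)]
          congr 2
          rw [ha]; field_simp
  have hfin := (ENNReal.add_le_add_iff_right ENNReal.ofReal_ne_top).1 hint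
  convert hfin using 2
  rw [ha]; ring

theorem sum_lintegral_Ioc (F : ℝ → ℝ≥0∞) {p : ℕ → ℝ} (hp : Monotone p) (k : ℕ) :
    ∑ i ∈ Finset.range k, ∫⁻ r in Ioc (p i) (p (i + 1)), F r = ∫⁻ r in Ioc (p 0) (p k), F r := by
  induction k with
  | zero => simp
  | succ k ih =>
    rw [Finset.sum_range_succ, ih, ← lintegral_union measurableSet_Ioc
      (Ioc_disjoint_Ioc_of_le le_rfl), Ioc_union_Ioc_eq_Ioc (hp (Nat.zero_le k)) (hp (Nat.le_succ k))]

/-- The discrete kinetic energy of a curve sampled at the points `i / N`. -/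
def discreteEnergy (N : ℕ) (f : ℝ → X) : ℝ :=
  N / 2 * ∑ i ∈ Finset.range N, dist (f (i / N)) (f ((i + 1 : ℕ) / N)) ^ 2

theorem discreteEnergy_nonneg (N : ℕ) (f : ℝ → X) : 0 ≤ discreteEnergy N f := by
  unfold discreteEnergy; positivity

theorem monotone_natCast_div (N : ℕ) : Monotone fun i : ℕ => (i : ℝ) / N := by
  intro i j hij
  have : (i : ℝ) ≤ j := by exact_mod_cast hij
  simp only
  gcongr

theorem ofReal_discreteEnergy_le_kineticEnergy (N : ℕ) (γ : Curve X) :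
    ENNReal.ofReal (discreteEnergy N (extend γ)) ≤ kineticEnergy γ := by
  unfold kineticEnergy
  split_ifs with hac
  swap
  · exact le_top
  rcases Nat.eq_zero_or_pos N with rfl | hN
  · simp [discreteEnergy]
  have hN' : (0 : ℝ) < N := by exact_mod_cast hN
  set f := extend γ
  have hmono := monotone_natCast_div N
  have hstep : ∀ i ∈ Finset.range N,
      ENNReal.ofReal (N * dist (f (i / N)) (f ((i + 1 : ℕ) / N)) ^ 2) ≤
        ∫⁻ r in Ioc ((i : ℝ) / N) ((i + 1 : ℕ) / N), metricSpeed f r ^ 2 := by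
    intro i hi
    have hlt : (i : ℝ) / N < (i + 1 : ℕ) / N := by
      push_cast; gcongr; linarith
    have h0 : (0 : ℝ) ≤ i / N := by positivity
    have h1 : ((i + 1 : ℕ) : ℝ) / N ≤ 1 := by
      rw [div_le_one hN']; exact_mod_cast Finset.mem_range.1 hi
    have := ofReal_dist_sq_div_le_lintegral hlt (hac.mono (by
      rw [uIcc_of_le hlt.le, uIcc_of_le zero_le_one]
      exact Icc_subset_Icc h0 h1))
    convert this using 2
    push_cast
    field_simp
    ring
  have hsum := Finset.sum_le_sum hstep
  rw [sum_lintegral_Ioc _ hmono, ← ENNReal.ofReal_sum_of_nonneg (fun _ _ => by positivity),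
    ← Finset.mul_sum] at hsum
  have e : discreteEnergy N f =
      1 / 2 * (N * ∑ i ∈ Finset.range N, dist (f (i / N)) (f ((i + 1 : ℕ) / N)) ^ 2) := by
    unfold discreteEnergy; ring
  rw [e, ENNReal.ofReal_mul (by norm_num)]
  have e2 : ENNReal.ofReal (1 / 2) = 1 / 2 := by
    rw [ENNReal.ofReal_div_of_pos (by norm_num)]; simp
  rw [e2]
  gcongr
  refine hsum.trans (lintegral_mono_set ?_)
  simp only [Nat.cast_zero, zero_div, div_self hN'.ne']
  exact Ioc_subset_Icc_self

/-- A monotone `v` sends disjoint intervals to disjoint intervals inside (v a, v b], and Lebesgue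
measure adds up their lengths. -/
theorem sum_abs_sub_le_of_monotoneOn {v : ℝ → ℝ} {a b : ℝ} (hv : MonotoneOn v (Icc a b))
    (hab : a ≤ b) {I : ℕ × (ℕ → ℝ × ℝ)} (hI : I ∈ AbsolutelyContinuousOnInterval.disjWithin a b) :
    ∑ i ∈ Finset.range I.1, |v (I.2 i).1 - v (I.2 i).2| ≤ v b - v a := by
  obtain ⟨hmem, hdisj⟩ := hI
  rw [uIcc_of_le hab] at hmem
  have habs : ∀ i ∈ Finset.range I.1, ENNReal.ofReal |v (I.2 i).1 - v (I.2 i).2| =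
      volume (uIoc (v (I.2 i).1) (v (I.2 i).2)) := by
    intro i _
    rw [uIoc, Real.volume_Ioc, max_sub_min_eq_abs']
  have hva : v a ≤ v b := hv ⟨le_rfl, hab⟩ ⟨hab, le_rfl⟩ hab
  rw [← ENNReal.ofReal_le_ofReal_iff (by linarith), ENNReal.ofReal_sum_of_nonneg
    (fun _ _ => abs_nonneg _), Finset.sum_congr rfl habs, ← measure_biUnion_finset _
    (fun _ _ => measurableSet_uIoc), ← Real.volume_Ioc]
  · refine measure_mono (iUnion₂_subset fun i hi => ?_)
    obtain ⟨h1, h2⟩ := hmem i hi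
    refine Ioc_subset_Ioc (le_min ?_ ?_) (max_le ?_ ?_)
    · exact hv ⟨le_rfl, hab⟩ h1 h1.1
    · exact hv ⟨le_rfl, hab⟩ h2 h2.1
    · exact hv h1 ⟨hab, le_rfl⟩ h1.2
    · exact hv h2 ⟨hab, le_rfl⟩ h2.2
  · intro i hi j hj hij
    have hd := hdisj hi hj hij
    obtain ⟨hi1, hi2⟩ := hmem i hi
    obtain ⟨hj1, hj2⟩ := hmem j hj
    simp only [Function.onFun, uIoc, Ioc_disjoint_Ioc] at hd ⊢
    have hmin : ∀ x ∈ Icc a b, ∀ y ∈ Icc a b, min (v x) (v y) = v (min x y) :=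
      fun x hx y hy => (hv.map_inf hx hy).symm
    have hmax : ∀ x ∈ Icc a b, ∀ y ∈ Icc a b, max (v x) (v y) = v (max x y) :=
      fun x hx y hy => (hv.map_sup hx hy).symm
    have hmin_mem : ∀ x ∈ Icc a b, ∀ y ∈ Icc a b, min x y ∈ Icc a b :=
      fun x hx y hy => ⟨le_min hx.1 hy.1, min_le_of_left_le hx.2⟩
    have hmax_mem : ∀ x ∈ Icc a b, ∀ y ∈ Icc a b, max x y ∈ Icc a b :=
      fun x hx y hy => ⟨le_max_of_le_left hx.1, max_le hx.2 hy.2⟩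
    have m1 := hmax_mem _ hi1 _ hi2
    have m2 := hmax_mem _ hj1 _ hj2
    have m3 := hmin_mem _ hi1 _ hi2
    have m4 := hmin_mem _ hj1 _ hj2
    rw [hmax _ hi1 _ hi2, hmax _ hj1 _ hj2, hmin _ hi1 _ hi2, hmin _ hj1 _ hj2,
      hmin _ m1 _ m2, hmax _ m3 _ m4]
    exact hv (hmin_mem _ m1 _ m2) (hmax_mem _ m3 _ m4) hd

section EnergyFunction

variable {f : ℝ → X} {v : ℝ → ℝ}

theorem monotoneOn_of_dist_sq_le
    (h : ∀ s t, 0 ≤ s → s < t → t ≤ 1 → dist (f s) (f t) ^ 2 ≤ (t - s) * (v t - v s)) :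
    MonotoneOn v (Icc 0 1) := by
  intro s hs t ht hst
  rcases hst.eq_or_lt with rfl | hlt
  · exact le_rfl
  have h1 := h s t hs.1 hlt ht.2
  have h2 : 0 ≤ (t - s) * (v t - v s) := (sq_nonneg _).trans h1
  have := nonneg_of_mul_nonneg_right h2 (sub_pos.2 hlt)
  linarith

theorem dist_le_sqrt_mul_sqrt
    (h : ∀ s t, 0 ≤ s → s < t → t ≤ 1 → dist (f s) (f t) ^ 2 ≤ (t - s) * (v t - v s))
    {s t : ℝ} (hs : s ∈ Icc (0 : ℝ) 1) (ht : t ∈ Icc (0 : ℝ) 1) :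
    dist (f s) (f t) ≤ √(dist s t) * √|v s - v t| := by
  wlog hst : s ≤ t generalizing s t
  · have := this ht hs (le_of_not_ge hst)
    rwa [dist_comm, dist_comm s, abs_sub_comm]
  rcases hst.eq_or_lt with rfl | hlt
  · simp
  have hmono := monotoneOn_of_dist_sq_le h hs ht hst
  rw [← Real.sqrt_mul dist_nonneg]
  apply Real.le_sqrt_of_sq_le
  rw [dist_comm s, Real.dist_eq, abs_of_nonneg (by linarith : 0 ≤ t - s), abs_sub_comm,
    abs_of_nonneg (by linarith : 0 ≤ v t - v s)]
  exact h s t hs.1 hlt ht.2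

/-- Here `v` plays the role of the accumulated energy ∫|ḟ|². By Cauchy–Schwarz the sum of distances
is at most √(total length) · √(v 1 - v 0). -/
theorem absolutelyContinuousOnInterval_of_dist_sq_le
    (h : ∀ s t, 0 ≤ s → s < t → t ≤ 1 → dist (f s) (f t) ^ 2 ≤ (t - s) * (v t - v s)) :
    AbsolutelyContinuousOnInterval f 0 1 := by
  have hmono := monotoneOn_of_dist_sq_le h
  have hV : 0 ≤ v 1 - v 0 := sub_nonneg.2 (hmono (by simp) (by simp) zero_le_one)
  rw [absolutelyContinuousOnInterval_iff]
  intro ε hε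
  refine ⟨ε ^ 2 / (v 1 - v 0 + 1), by positivity, fun I hI hl => ?_⟩
  have hmem := hI.1
  rw [uIcc_of_le zero_le_one] at hmem
  have hsum : ∑ i ∈ Finset.range I.1, dist (f (I.2 i).1) (f (I.2 i).2) ≤
      √(∑ i ∈ Finset.range I.1, dist (I.2 i).1 (I.2 i).2) *
        √(∑ i ∈ Finset.range I.1, |v (I.2 i).1 - v (I.2 i).2|) :=
    (Finset.sum_le_sum fun i hi => dist_le_sqrt_mul_sqrt h (hmem i hi).1 (hmem i hi).2).trans
      (Real.sum_sqrt_mul_sqrt_le _ (fun _ => dist_nonneg) (fun _ => abs_nonneg _))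
  refine hsum.trans_lt ?_
  rw [← Real.sqrt_mul (Finset.sum_nonneg fun _ _ => dist_nonneg), Real.sqrt_lt' hε]
  have hv := sum_abs_sub_le_of_monotoneOn hmono zero_le_one hI
  have h0 : 0 ≤ ∑ i ∈ Finset.range I.1, dist (I.2 i).1 (I.2 i).2 :=
    Finset.sum_nonneg fun _ _ => dist_nonneg
  rw [lt_div_iff₀ (by linarith)] at hl
  refine lt_of_le_of_lt ?_ hl
  gcongr
  linarith

/-- At a differentiability point of `v` the squared speed is at most v', and the integral of v' is
at most the increment of the monotone function `v`. -/
theorem lintegral_metricSpeed_sq_le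
    (h : ∀ s t, 0 ≤ s → s < t → t ≤ 1 → dist (f s) (f t) ^ 2 ≤ (t - s) * (v t - v s)) :
    ∫⁻ t in Icc (0 : ℝ) 1, metricSpeed f t ^ 2 ≤ ENNReal.ofReal (v 1 - v 0) := by
  have hmono := monotoneOn_of_dist_sq_le h
  have hmono' : MonotoneOn v (uIcc 0 1) := by rwa [uIcc_of_le zero_le_one]
  have hV : 0 ≤ v 1 - v 0 := sub_nonneg.2 (hmono (by simp) (by simp) zero_le_one)
  have hspeed : ∀ t ∈ Ioo (0 : ℝ) 1, DifferentiableAt ℝ v t →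
      metricSpeed f t ^ 2 ≤ ENNReal.ofReal (deriv v t) := by
    intro t ht hd
    have hsl := hasDerivAt_iff_tendsto_slope.1 hd.hasDerivAt
    have hlim := ENNReal.tendsto_ofReal (hsl.sqrt)
    have hle : metricSpeed f t ≤ ENNReal.ofReal (√(deriv v t)) := by
      rw [← hlim.limsup_eq]
      refine limsup_le_limsup ?_
      have hnear : Icc (0 : ℝ) 1 ∈ 𝓝[≠] t := nhdsWithin_le_nhds (Icc_mem_nhds ht.1 ht.2)
      filter_upwards [self_mem_nhdsWithin, hnear] with s hs hs01
      have hst : 0 < dist s t := dist_pos.2 hs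
      rw [edist_dist, edist_dist, ← ENNReal.ofReal_div_of_pos hst]
      apply ENNReal.ofReal_le_ofReal
      have hts : t ∈ Icc (0 : ℝ) 1 := ⟨ht.1.le, ht.2.le⟩
      have h1 := dist_le_sqrt_mul_sqrt h hs01 hts
      have h2 : _root_.slope v t s = |v s - v t| / dist s t := by
        rw [slope_def_field, Real.dist_eq]
        rcases lt_or_gt_of_ne hs with hlt | hgt
        · have := hmono hs01 hts hlt.le
          rw [abs_of_nonpos (by linarith), abs_of_neg (by linarith), neg_div_neg_eq]
        · have := hmono hts hs01 (le_of_lt hgt)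
          rw [abs_of_nonneg (by linarith), abs_of_pos (by linarith)]
      rw [h2, Real.sqrt_div (abs_nonneg _), div_le_div_iff₀ hst (Real.sqrt_pos.2 hst)]
      calc dist (f s) (f t) * √(dist s t) ≤ √(dist s t) * √|v s - v t| * √(dist s t) := by gcongr
        _ = √|v s - v t| * (√(dist s t) * √(dist s t)) := by ring
        _ = _ := by rw [Real.mul_self_sqrt dist_nonneg]
    have hd0 : 0 ≤ deriv v t := by
      rw [← derivWithin_of_mem_nhds (Icc_mem_nhds ht.1 ht.2)]
      exact hmono.derivWithin_nonneg
    calc metricSpeed f t ^ 2 ≤ ENNReal.ofReal (√(deriv v t)) ^ 2 := by gcongr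
      _ = _ := by rw [← ENNReal.ofReal_pow (Real.sqrt_nonneg _), Real.sq_sqrt hd0]
  have hae : ∀ᵐ t, t ∈ Ioo (0 : ℝ) 1 → metricSpeed f t ^ 2 ≤ ENNReal.ofReal (deriv v t) := by
    filter_upwards [hmono.ae_differentiableWithinAt_of_mem] with t ht ht01
    exact hspeed t ht01 ((ht ⟨ht01.1.le, ht01.2.le⟩).differentiableAt
      (Icc_mem_nhds ht01.1 ht01.2))
  have hint := hmono'.intervalIntegrable_deriv
  have hmem := hmono'.intervalIntegral_deriv_mem_uIcc
  rw [uIcc_of_le hV] at hmem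
  rw [restrict_Ioo_eq_restrict_Icc.symm]
  calc ∫⁻ t in Ioo (0 : ℝ) 1, metricSpeed f t ^ 2
      ≤ ∫⁻ t in Ioo (0 : ℝ) 1, ENNReal.ofReal (deriv v t) :=
        lintegral_mono_ae ((ae_restrict_iff' measurableSet_Ioo).2 hae)
    _ = ENNReal.ofReal (∫ t in Ioo (0 : ℝ) 1, deriv v t) := by
        rw [ofReal_integral_eq_lintegral_ofReal]
        · exact ((intervalIntegrable_iff_integrableOn_Ioo_of_le zero_le_one).1 hint)
        · rw [EventuallyLE, ae_restrict_iff' measurableSet_Ioo]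
          refine Eventually.of_forall fun t ht => ?_
          rw [Pi.zero_apply, ← derivWithin_of_mem_nhds (Icc_mem_nhds ht.1 ht.2)]
          exact hmono.derivWithin_nonneg
    _ ≤ _ := by
        apply ENNReal.ofReal_le_ofReal
        rw [← integral_Ioc_eq_integral_Ioo, ← intervalIntegral.integral_of_le zero_le_one]
        exact hmem.2

end EnergyFunction

theorem continuous_extend (γ : Curve X) : Continuous (extend γ) :=
  γ.continuous.comp continuous_projIcc

theorem dist_sq_le_mul_sum (f : ℕ → X) {m n : ℕ} (hmn : m ≤ n) :
    dist (f m) (f n) ^ 2 ≤ ((n : ℝ) - m) * ∑ i ∈ Finset.Ico m n, dist (f i) (f (i + 1)) ^ 2 := by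
  have h1 := dist_le_Ico_sum_dist f hmn
  have h2 := sq_sum_le_card_mul_sum_sq (s := Finset.Ico m n) (f := fun i => dist (f i) (f (i + 1)))
  rw [Nat.card_Ico, Nat.cast_sub hmn] at h2
  refine le_trans ?_ h2
  gcongr

/-- Compactness of the accumulated discrete energies: their limit `v` inherits from the grid the
Cauchy–Schwarz bound d² ≤ (t - s)(v t - v s). That bound gives absolute continuity as well as the
energy estimate. -/
theorem kineticEnergy_le_liminf_discreteEnergy (γ : Curve X) {N : ℕ → ℕ}
    (hN : Tendsto N atTop atTop) :
    kineticEnergy γ ≤ liminf (fun k => ENNReal.ofReal (discreteEnergy (N k) (extend γ))) atTop := by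
  refine le_of_forall_gt_imp_ge_of_dense fun c hc => ?_
  obtain ⟨K, hK, hKc⟩ := exists_between hc
  refine le_trans ?_ hKc.le
  lift K to NNReal using hKc.ne_top
  have hfreq : ∃ᶠ k in atTop, discreteEnergy (N k) (extend γ) ≤ K := by
    refine (frequently_lt_of_liminf_lt (by isBoundedDefault) hK).mono fun k hk => ?_
    exact ((ENNReal.ofReal_lt_coe_iff (discreteEnergy_nonneg _ _)).1 hk).le
  set f := extend γ with hf
  have hfc : Continuous f := continuous_extend γ
  have hne : (atTop ⊓ 𝓟 {k | discreteEnergy (N k) f ≤ K}).NeBot := frequently_iff_neBot.1 hfreq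
  -- An ultrafilter supplies the limits at all times at once, in place of Helly's selection theorem.
  set F : Ultrafilter ℕ := Ultrafilter.of (atTop ⊓ 𝓟 {k | discreteEnergy (N k) f ≤ K})
  have hF := Ultrafilter.of_le (atTop ⊓ 𝓟 {k | discreteEnergy (N k) f ≤ K})
  have hFtop : (F : Filter ℕ) ≤ atTop := hF.trans inf_le_left
  have hFK : ∀ᶠ k in (F : Filter ℕ), discreteEnergy (N k) f ≤ K :=
    le_principal_iff.1 (hF.trans inf_le_right)
  set a : ℕ → ℕ → ℝ := fun k i => dist (f (i / N k)) (f ((i + 1 : ℕ) / N k)) ^ 2 with ha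
  set V : ℕ → ℝ → ℝ := fun k t => N k * ∑ i ∈ Finset.range ⌊t * N k⌋₊, a k i with hV
  have hVmem : ∀ t ∈ Icc (0 : ℝ) 1, ∀ᶠ k in (F : Filter ℕ), V k t ∈ Icc (0 : ℝ) (2 * K) := by
    intro t ht
    filter_upwards [hFK] with k hk
    refine ⟨by simp only [hV, ha]; positivity, ?_⟩
    have hfl : ⌊t * N k⌋₊ ≤ N k :=
      Nat.floor_le_of_le (mul_le_of_le_one_left (Nat.cast_nonneg _) ht.2)
    have h1 : ∑ i ∈ Finset.range ⌊t * N k⌋₊, a k i ≤ ∑ i ∈ Finset.range (N k), a k i :=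
      Finset.sum_le_sum_of_subset_of_nonneg (Finset.range_subset_range.2 hfl)
        fun _ _ _ => by simp only [ha]; positivity
    have h2 := mul_le_mul_of_nonneg_left h1 (Nat.cast_nonneg (α := ℝ) (N k))
    simp only [discreteEnergy] at hk
    simp only [hV]
    linarith
  have hlim : ∀ t, ∃ l, t ∈ Icc (0 : ℝ) 1 →
      l ∈ Icc (0 : ℝ) (2 * K) ∧ Tendsto (fun k => V k t) F (𝓝 l) := by
    intro t
    by_cases ht : t ∈ Icc (0 : ℝ) 1
    · obtain ⟨l, hl, hle⟩ := isCompact_Icc.ultrafilter_le_nhds (F.map fun k => V k t)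
        (le_principal_iff.2 (hVmem t ht))
      exact ⟨l, fun _ => ⟨hl, hle⟩⟩
    · exact ⟨0, fun h => absurd h ht⟩
  choose v hv using hlim
  have hNF : Tendsto (fun k => (N k : ℝ)) F atTop :=
    tendsto_natCast_atTop_atTop.comp (hN.mono_left hFtop)
  have hfloor : ∀ t : ℝ, 0 ≤ t →
      Tendsto (fun k => ((⌊t * N k⌋₊ : ℕ) : ℝ) / N k) F (𝓝 t) :=
    fun t ht => (tendsto_nat_floor_mul_div_atTop ht).comp hNF
  have key : ∀ s t, 0 ≤ s → s < t → t ≤ 1 → dist (f s) (f t) ^ 2 ≤ (t - s) * (v t - v s) := by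
    intro s t hs hst ht
    have hs1 := (hv s ⟨hs, by linarith⟩).2
    have ht1 := (hv t ⟨by linarith, ht⟩).2
    have hl : Tendsto (fun k => dist (f (((⌊s * N k⌋₊ : ℕ) : ℝ) / N k))
        (f (((⌊t * N k⌋₊ : ℕ) : ℝ) / N k)) ^ 2) F (𝓝 (dist (f s) (f t) ^ 2)) :=
      (((hfc.tendsto s).comp (hfloor s hs)).dist
        ((hfc.tendsto t).comp (hfloor t (by linarith)))).pow 2
    have hr := ((hfloor t (by linarith)).sub (hfloor s hs)).mul (ht1.sub hs1)
    refine le_of_tendsto_of_tendsto hl hr ?_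
    filter_upwards [hNF.eventually_gt_atTop 0] with k hk
    have hmn : ⌊s * N k⌋₊ ≤ ⌊t * N k⌋₊ := Nat.floor_mono (by gcongr)
    have h1 := dist_sq_le_mul_sum (fun i : ℕ => f ((i : ℝ) / N k)) hmn
    refine h1.trans (le_of_eq ?_)
    rw [Finset.sum_Ico_eq_sub _ hmn]
    simp only [hV, ha]
    field_simp
  unfold kineticEnergy
  rw [if_pos (absolutelyContinuousOnInterval_of_dist_sq_le key)]
  have h0 := (hv 0 (by simp)).1
  have h1 := (hv 1 (by simp)).1
  calc 1 / 2 * ∫⁻ t in Icc (0 : ℝ) 1, metricSpeed f t ^ 2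
      ≤ 1 / 2 * ENNReal.ofReal (v 1 - v 0) := by
        gcongr; exact lintegral_metricSpeed_sq_le key
    _ ≤ 1 / 2 * ENNReal.ofReal (2 * K) := by
        gcongr; linarith [h0.1, h1.2]
    _ = K := by
        rw [ENNReal.ofReal_mul (by norm_num), ENNReal.ofReal_coe_nnreal, ← mul_assoc]
        have : (1 / 2 : ℝ≥0∞) * ENNReal.ofReal 2 = 1 := by
          simp [ENNReal.inv_mul_cancel]
        rw [this, one_mul]

/-! ### Fatou's lemma for Riemann sums. -/

theorem liminf_add_liminf_le (a b : ℕ → ℝ≥0∞) :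
    liminf a atTop + liminf b atTop ≤ liminf (fun n => a n + b n) atTop := by
  simp only [liminf_eq_iSup_iInf_of_nat]
  rw [ENNReal.iSup_add_iSup_of_monotone]
  · refine iSup_mono fun n => le_iInf₂ fun i hi => ?_
    exact add_le_add (iInf₂_le i hi) (iInf₂_le i hi)
  · exact fun m n hmn => le_iInf₂ fun i hi => iInf₂_le i (hmn.trans hi)
  · exact fun m n hmn => le_iInf₂ fun i hi => iInf₂_le i (hmn.trans hi)

theorem lintegral_Ioc_natCeil (G : ℕ → ℝ≥0∞) {N : ℕ} (hN : 0 < N) :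
    ∫⁻ t in Ioc (0 : ℝ) 1, G (⌈t * N⌉₊ - 1) =
      ∑ i ∈ Finset.range N, G i * ENNReal.ofReal (1 / N) := by
  have hN' : (0 : ℝ) < N := by exact_mod_cast hN
  have h := sum_lintegral_Ioc (fun t : ℝ => G (⌈t * N⌉₊ - 1)) (monotone_natCast_div N) N
  simp only [Nat.cast_zero, zero_div, div_self hN'.ne'] at h
  rw [← h]
  refine Finset.sum_congr rfl fun i _ => ?_
  have hcongr : ∫⁻ t in Ioc ((i : ℝ) / N) ((i + 1 : ℕ) / N), G (⌈t * N⌉₊ - 1) =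
      ∫⁻ t in Ioc ((i : ℝ) / N) ((i + 1 : ℕ) / N), G i := by
    refine setLIntegral_congr_fun measurableSet_Ioc fun t ht => ?_
    have hceil : ⌈t * N⌉₊ = i + 1 := by
      rw [Nat.ceil_eq_iff (Nat.succ_ne_zero i)]
      constructor
      · simpa using (div_lt_iff₀ hN').1 ht.1
      · exact (le_div_iff₀ hN').1 ht.2
    simp only [hceil, Nat.add_sub_cancel]
  rw [hcongr, setLIntegral_const, Real.volume_Ioc]
  congr 2
  push_cast
  ring

/-- Lower semicontinuity of an integral along Riemann sums with arbitrary nearby sample points. -/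
theorem lintegral_le_liminf_sum {F : ℝ → ℝ≥0∞} (hF : LowerSemicontinuous F) {N : ℕ → ℕ}
    (hN : Tendsto N atTop atTop) (hNpos : ∀ k, 0 < N k) (J : ℕ → ℕ → ℕ)
    (hJ : ∀ k i, J k i = i ∨ J k i = i + 1) :
    ∫⁻ t in Icc (0 : ℝ) 1, F t ≤
      liminf (fun k => ∑ i ∈ Finset.range (N k), F (J k i / N k) * ENNReal.ofReal (1 / N k))
        atTop := by
  rw [← restrict_Ioc_eq_restrict_Icc]
  have hpt : ∀ t ∈ Ioc (0 : ℝ) 1,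
      -- The Riemann sum is the integral of a step function; ⌈tN⌉ - 1 is the index of the cell (i/N,
      -- (i+1)/N] containing t > 0.
      F t ≤ liminf (fun k => F ((J k (⌈t * N k⌉₊ - 1) : ℕ) / N k)) atTop := by
    intro t ht
    have hlim : Tendsto (fun k => ((J k (⌈t * N k⌉₊ - 1) : ℕ) : ℝ) / N k) atTop (𝓝 t) := by
      have hinv : Tendsto (fun k => 1 / (N k : ℝ)) atTop (𝓝 0) :=
        tendsto_one_div_atTop_nhds_zero_nat.comp hN
      rw [tendsto_iff_dist_tendsto_zero]
      refine squeeze_zero (fun _ => dist_nonneg) (fun k => ?_) hinv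
      have hk : (0 : ℝ) < N k := by exact_mod_cast hNpos k
      have hpos : 0 < t * N k := mul_pos ht.1 hk
      have hc1 : 1 ≤ ⌈t * N k⌉₊ := Nat.one_le_iff_ne_zero.2 (Nat.ceil_pos.2 hpos).ne'
      have hc2 := Nat.le_ceil (t * N k)
      have hc3 := Nat.ceil_lt_add_one hpos.le
      rw [Real.dist_eq, div_sub' hk.ne', abs_div, abs_of_pos hk]
      gcongr
      rw [abs_le]
      rcases hJ k (⌈t * N k⌉₊ - 1) with h | h <;> rw [h] <;> push_cast [Nat.cast_sub hc1] <;>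
        constructor <;> linarith
    exact (LowerSemicontinuousAt.le_liminf (hF t)).trans (liminf_le_liminf_of_le hlim)
  calc ∫⁻ t in Ioc (0 : ℝ) 1, F t
      ≤ ∫⁻ t in Ioc (0 : ℝ) 1, liminf (fun k => F ((J k (⌈t * N k⌉₊ - 1) : ℕ) / N k)) atTop :=
        setLIntegral_mono' measurableSet_Ioc hpt
    _ ≤ liminf (fun k => ∫⁻ t in Ioc (0 : ℝ) 1, F ((J k (⌈t * N k⌉₊ - 1) : ℕ) / N k)) atTop := by
        refine lintegral_liminf_le fun k => ?_
        exact (measurable_from_nat (f := fun i => F ((J k (i - 1) : ℕ) / N k))).comp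
          (Nat.measurable_ceil.comp (measurable_id.mul_const _))
    _ = _ := by
        congr 1
        ext k
        exact lintegral_Ioc_natCeil (fun i => F ((J k i : ℕ) / N k)) (hNpos k)

/-! ### The recovery curve and its action. -/

section Recovery

variable {E : X → EReal} {lam : ℝ}

/-- The curve `t ↦ S_{h(t)} γ_t` with `h(t) = η + ε min(t, 1 - t)`. -/
def recoveryCurve (hE : StandingAssumptions E lam) {η ε : ℝ} (hη : 0 ≤ η) (hε : 0 ≤ ε)
    (γ : Curve X) : Curve X where
  toFun t := semigroup E lam (η + ε * min (t : ℝ) (1 - t)) (γ t)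
  continuous_toFun := by
    refine (continuousOn_uncurry_semigroup hE).comp_continuous
      (f := fun t : unitInterval => (η + ε * min (t : ℝ) (1 - t), γ t)) (by fun_prop) fun t => ?_
    have : 0 ≤ min (t : ℝ) (1 - t) := le_min t.2.1 (by linarith [t.2.2])
    exact ⟨by simp only [mem_Ici]; positivity, mem_univ _⟩

variable (hE : StandingAssumptions E lam) {η ε : ℝ} (hη : 0 ≤ η)

theorem extend_recoveryCurve (hε : 0 ≤ ε) (γ : Curve X) {t : ℝ} (ht : t ∈ Icc (0 : ℝ) 1) :
    extend (recoveryCurve hE hη hε γ) t =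
      semigroup E lam (η + ε * min t (1 - t)) (extend γ t) := by
  simp [extend, recoveryCurve, projIcc_of_mem zero_le_one ht]

/-- On each cell the node flowed for the longer time plays the role of S_{h+δ}p: the right one
before the midpoint, the left one after it. The slope is controlled at that node. The even number of
cells makes the midpoint a node. -/
theorem recoveryCurve_step (hε : 0 < ε) (γ : Curve X)
    (h0 : E (semigroup E lam η (γ 0)) ≠ ⊤) (h1 : E (semigroup E lam η (γ 1)) ≠ ⊤) {M : ℕ}
    (hM : 0 < M) {i : ℕ} (hi : i < 2 * M) (f g : ℕ → X) (e : ℕ → ℝ)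
    (hf : f = fun j : ℕ => extend γ (j / (2 * M : ℕ)))
    (hg : g = fun j : ℕ => extend (recoveryCurve hE hη hε.le γ) (j / (2 * M : ℕ)))
    (he : e = fun j => (E (g j)).toReal) :
    globalSlope E lam (g (if i < M then i + 1 else i)) ≠ ⊤ ∧
    Real.exp (lam * (ε / (2 * M : ℕ))) / 2 * dist (g i) (g (i + 1)) ^ 2 +
      Real.exp (-(3 * |lam| * (ε / (2 * M : ℕ)))) *
        (globalSlope E lam (g (if i < M then i + 1 else i))).toReal ^ 2 *
          ((ε / (2 * M : ℕ)) ^ 2 / 2) +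
      (∫ r in (0 : ℝ)..(ε / (2 * M : ℕ)), Real.exp (lam * r)) *
        (if i < M then e (i + 1) - e i else e i - e (i + 1)) ≤
      Real.exp (2 * |lam| * (η + ε)) * dist (f i) (f (i + 1)) ^ 2 / 2 := by
  have hM' : (0 : ℝ) < M := by exact_mod_cast hM
  have hN : (0 : ℝ) < (2 * M : ℕ) := by push_cast; positivity
  set δ := ε / (2 * M : ℕ) with hδ
  have hδ0 : 0 < δ := by positivity
  set h : ℕ → ℝ := fun j => η + ε * min ((j : ℝ) / (2 * M : ℕ)) (1 - j / (2 * M : ℕ)) with hh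
  have hmem : ∀ j, j ≤ 2 * M → (j : ℝ) / (2 * M : ℕ) ∈ Icc (0 : ℝ) 1 := fun j hj =>
    ⟨by positivity, by rw [div_le_one hN]; exact_mod_cast hj⟩
  have hgS : ∀ j, j ≤ 2 * M → g j = semigroup E lam (h j) (f j) := fun j hj => by
    rw [hg, hf]
    exact extend_recoveryCurve hE hη hε.le γ (hmem j hj)
  have hh0 : ∀ j, j ≤ 2 * M → 0 ≤ h j := fun j hj => by
    have := hmem j hj
    have : 0 ≤ min ((j : ℝ) / (2 * M : ℕ)) (1 - j / (2 * M : ℕ)) :=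
      le_min this.1 (by linarith [this.2])
    simp only [hh]; positivity
  have hhle : ∀ j, j ≤ 2 * M → h j ≤ η + ε := fun j hj => by
    have h2 := min_le_left ((j : ℝ) / (2 * M : ℕ)) (1 - j / (2 * M : ℕ))
    have h3 := mul_le_mul_of_nonneg_left (h2.trans (hmem j hj).2) hε.le
    simp only [hh]; linarith
  have hfin : ∀ j, j ≤ 2 * M → E (semigroup E lam (h j) (f j)) ≠ ⊤ := fun j hj => by
    rcases Nat.eq_zero_or_pos j with rfl | hj0
    · have e1 : h 0 = η := by simp [hh]
      have e2 : f 0 = γ 0 := by simp [hf, extend]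
      rwa [e1, e2]
    rcases hj.eq_or_lt with rfl | hlt
    · have e0 : ((2 * M : ℕ) : ℝ) / (2 * M : ℕ) = 1 := div_self hN.ne'
      have e1 : h (2 * M) = η := by simp only [hh, e0]; simp
      have e2 : f (2 * M) = γ 1 := by simp only [hf, e0]; simp [extend]
      rwa [e1, e2]
    · refine energy_semigroup_ne_top hE _ ?_
      have : 0 < min ((j : ℝ) / (2 * M : ℕ)) (1 - j / (2 * M : ℕ)) := by
        refine lt_min (by positivity) (sub_pos.2 ?_)
        rw [div_lt_one hN]; exact_mod_cast hlt
      simp only [hh]; positivity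
  have hexp : ∀ j, j ≤ 2 * M → Real.exp (2 * |lam| * h j) ≤ Real.exp (2 * |lam| * (η + ε)) :=
    fun j hj => by gcongr; exact hhle j hj
  by_cases hiM : i < M
  · simp only [if_pos hiM]
    have hstep : h (i + 1) = h i + δ := by
      have hi1 : ((i + 1 : ℕ) : ℝ) ≤ M := by exact_mod_cast hiM
      have a1 : ((i + 1 : ℕ) : ℝ) / (2 * M : ℕ) ≤ 1 - ((i + 1 : ℕ) : ℝ) / (2 * M : ℕ) := by
        rw [le_sub_iff_add_le, ← add_div, div_le_one hN]; push_cast at hi1 ⊢; linarith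
      have a2 : (i : ℝ) / (2 * M : ℕ) ≤ 1 - (i : ℝ) / (2 * M : ℕ) := by
        rw [le_sub_iff_add_le, ← add_div, div_le_one hN]; push_cast at hi1 ⊢; linarith
      simp only [hh]
      rw [min_eq_left a1, min_eq_left a2, hδ]
      push_cast; ring
    have hc := semigroup_comparison hE (f (i + 1)) (f i) (hh0 i hi.le) hδ0 (hfin i hi.le)
    rw [← hstep, ← hgS (i + 1) hi, ← hgS i hi.le, dist_comm (g (i + 1)), dist_comm (f (i + 1))] at hc
    refine ⟨?_, ?_⟩
    · rw [hgS (i + 1) hi]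
      exact globalSlope_semigroup_ne_top hE _ (by rw [hstep]; linarith [hh0 i hi.le])
    · rw [he]
      refine hc.trans ?_
      have := hexp i hi.le
      gcongr
  · simp only [if_neg hiM]
    have hstep : h i = h (i + 1) + δ := by
      have hi1 : (M : ℝ) ≤ i := by exact_mod_cast not_lt.1 hiM
      have a1 : 1 - ((i + 1 : ℕ) : ℝ) / (2 * M : ℕ) ≤ ((i + 1 : ℕ) : ℝ) / (2 * M : ℕ) := by
        rw [sub_le_iff_le_add, ← add_div, one_le_div hN]; push_cast at hi1 ⊢; linarith
      have a2 : 1 - (i : ℝ) / (2 * M : ℕ) ≤ (i : ℝ) / (2 * M : ℕ) := by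
        rw [sub_le_iff_le_add, ← add_div, one_le_div hN]; push_cast at hi1 ⊢; linarith
      simp only [hh]
      rw [min_eq_right a1, min_eq_right a2, hδ]
      push_cast; ring
    have hc := semigroup_comparison hE (f i) (f (i + 1)) (hh0 (i + 1) hi) hδ0 (hfin (i + 1) hi)
    rw [← hstep, ← hgS (i + 1) hi, ← hgS i hi.le] at hc
    refine ⟨?_, ?_⟩
    · rw [hgS i hi.le]
      exact globalSlope_semigroup_ne_top hE _ (by rw [hstep]; linarith [hh0 (i + 1) hi])
    · rw [he]
      refine hc.trans ?_
      have := hexp (i + 1) hi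
      gcongr

/-- Reflecting the values after `M` about the level e M turns the sum into a single telescoping one.
-/
theorem sum_range_two_mul_tent (e : ℕ → ℝ) (M : ℕ) :
    ∑ i ∈ Finset.range (2 * M), (if i < M then e (i + 1) - e i else e i - e (i + 1)) =
      2 * e M - e 0 - e (2 * M) := by
  have h : ∀ i, (if i < M then e (i + 1) - e i else e i - e (i + 1)) =
      (if i + 1 ≤ M then e (i + 1) else 2 * e M - e (i + 1)) -
        (if i ≤ M then e i else 2 * e M - e i) := by
    intro i
    split_ifs <;> try omega
    · ring
    · have : i = M := by omega
      subst this; ring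
    · ring
  rw [Finset.sum_congr rfl fun i _ => h i,
    Finset.sum_range_sub (fun i => if i ≤ M then e i else 2 * e M - e i)]
  rcases Nat.eq_zero_or_pos M with rfl | hM
  · simp; ring
  · rw [if_neg (by omega), if_pos (Nat.zero_le M)]; ring

theorem tendsto_mul_integral_exp (lam ε : ℝ) (hε : 0 < ε) {a : ℕ → ℝ}
    (ha : Tendsto a atTop atTop) :
    Tendsto (fun k => a k * ∫ r in (0 : ℝ)..(ε / a k), Real.exp (lam * r)) atTop (𝓝 ε) := by
  have hc : Continuous fun r => Real.exp (lam * r) := by fun_prop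
  have hd := (hc.integral_hasStrictDerivAt 0 0).hasDerivAt
  have hs := hasDerivAt_iff_tendsto_slope.1 hd
  have hδ : Tendsto (fun k => ε / a k) atTop (𝓝[≠] 0) := by
    refine tendsto_nhdsWithin_iff.2 ⟨tendsto_const_nhds.div_atTop ha, ?_⟩
    filter_upwards [ha.eventually_gt_atTop 0] with k hk
    exact (div_pos hε hk).ne'
  have h := (hs.comp hδ).const_mul ε
  simp only [mul_zero, Real.exp_zero, mul_one] at h
  refine h.congr' ?_
  filter_upwards [ha.eventually_gt_atTop 0] with k hk
  simp only [Function.comp, slope_def_field, intervalIntegral.integral_same, sub_zero]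
  field_simp

/-- The action of the recovery curve is controlled by the kinetic energy of the original curve and
by the energy at the end points and at the midpoint. -/
theorem action_recoveryCurve_le (hε : 0 < ε) (γ : Curve X) (hγ : kineticEnergy γ ≠ ⊤)
    (h0 : E (semigroup E lam η (γ 0)) ≠ ⊤) (h1 : E (semigroup E lam η (γ 1)) ≠ ⊤) :
    action E ε (recoveryCurve hE hη hε.le γ) ≤
      ENNReal.ofReal (Real.exp (2 * |lam| * (η + ε)) * (kineticEnergy γ).toReal +
        ε * ((E (semigroup E lam η (γ 0))).toReal + (E (semigroup E lam η (γ 1))).toReal -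
          2 * (E (extend (recoveryCurve hE hη hε.le γ) (1 / 2))).toReal)) := by
  set ρ := recoveryCurve hE hη hε.le γ with hρ
  set A := (kineticEnergy γ).toReal with hA
  set e0 := (E (semigroup E lam η (γ 0))).toReal with he0
  set e1 := (E (semigroup E lam η (γ 1))).toReal with he1
  set em := (E (extend ρ (1 / 2))).toReal with hem
  set N : ℕ → ℕ := fun k => 2 * (k + 1) with hN
  have hNpos : ∀ k, 0 < N k := fun k => by simp only [hN]; omega
  have hNtop : Tendsto N atTop atTop :=
    tendsto_atTop_mono (fun k => by simp only [hN, id]; omega) tendsto_id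
  have hNR : Tendsto (fun k => (N k : ℝ)) atTop atTop := tendsto_natCast_atTop_atTop.comp hNtop
  -- The end of each cell at which `recoveryCurve_step` controls the slope.
  set J : ℕ → ℕ → ℕ := fun k i => if i < k + 1 then i + 1 else i with hJ
  set c : ℝ≥0∞ := ENNReal.ofReal (ε ^ 2 / 2) with hc
  set F : ℝ → ℝ≥0∞ := fun t => c * globalSlope E lam (extend ρ t) ^ 2 with hF
  have hFlsc : LowerSemicontinuous F := by
    have hL : LowerSemicontinuous fun t => globalSlope E lam (extend ρ t) :=
      fun t z hz => ((continuous_extend ρ).tendsto t).eventually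
        (lowerSemicontinuous_globalSlope hE.lsc hE.ne_bot _ z hz)
    have hcont : Continuous fun x : ℝ≥0∞ => c * x ^ 2 :=
      (ENNReal.continuous_const_mul ENNReal.ofReal_ne_top).comp (ENNReal.continuous_pow 2)
    exact hcont.comp_lowerSemicontinuous hL fun a b hab => by
      simp only
      gcongr
  have hkin := kineticEnergy_le_liminf_discreteEnergy ρ hNtop
  have hfis := lintegral_le_liminf_sum hFlsc hNtop hNpos J (fun k i => by
    simp only [hJ]; split_ifs <;> simp)
  set B : ℕ → ℝ := fun k => Real.exp (3 * |lam| * (ε / N k)) *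
    (Real.exp (2 * |lam| * (η + ε)) * A -
      N k * (∫ r in (0 : ℝ)..(ε / N k), Real.exp (lam * r)) * (2 * em - e0 - e1)) with hB
  -- N times the sum of the cell estimates; the prefactor exp(3|λ|δ) in `B` clears the weights on
  -- the left.
  have hstep : ∀ k, ENNReal.ofReal (discreteEnergy (N k) (extend ρ)) +
      ∑ i ∈ Finset.range (N k), F (J k i / N k) * ENNReal.ofReal (1 / N k) ≤
      ENNReal.ofReal (B k) := by
    intro k
    set f : ℕ → X := fun j => extend γ (j / (N k : ℕ)) with hf
    set g : ℕ → X := fun j => extend ρ (j / (N k : ℕ)) with hg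
    set e : ℕ → ℝ := fun j => (E (g j)).toReal with he
    set ℓ : ℕ → ℝ := fun i => (globalSlope E lam (g (J k i))).toReal with hℓ
    have hst := fun i (hi : i < N k) =>
      recoveryCurve_step hE hη hε γ h0 h1 (Nat.succ_pos k) hi f g e hf hg he
    have hNk : (0 : ℝ) < N k := by exact_mod_cast hNpos k
    have hFsum : ∑ i ∈ Finset.range (N k), F (J k i / N k) * ENNReal.ofReal (1 / N k) =
        ENNReal.ofReal (∑ i ∈ Finset.range (N k), ε ^ 2 / 2 * ℓ i ^ 2 * (1 / N k)) := by
      rw [ENNReal.ofReal_sum_of_nonneg fun _ _ => by positivity]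
      refine Finset.sum_congr rfl fun i hi => ?_
      have hne := (hst i (Finset.mem_range.1 hi)).1
      rw [ENNReal.ofReal_mul (by positivity), ENNReal.ofReal_mul (by positivity),
        ENNReal.ofReal_pow ENNReal.toReal_nonneg, ENNReal.ofReal_toReal hne]
    rw [hFsum, ← ENNReal.ofReal_add (discreteEnergy_nonneg _ _)
      (Finset.sum_nonneg fun _ _ => by positivity)]
    apply ENNReal.ofReal_le_ofReal
    set δ := ε / N k with hδ
    have hδ0 : 0 < δ := by positivity
    set I := ∫ r in (0 : ℝ)..δ, Real.exp (lam * r) with hI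
    have hsum := Finset.sum_le_sum fun i (hi : i ∈ Finset.range (N k)) =>
      (hst i (Finset.mem_range.1 hi)).2
    rw [Finset.sum_add_distrib, Finset.sum_add_distrib, ← Finset.mul_sum, ← Finset.mul_sum,
      sum_range_two_mul_tent, ← Finset.sum_mul, ← Finset.mul_sum, ← Finset.sum_div,
      ← Finset.mul_sum] at hsum
    have hDf : discreteEnergy (N k) (extend γ) ≤ A := by
      have := ofReal_discreteEnergy_le_kineticEnergy (N k) γ
      rwa [← ENNReal.ofReal_toReal hγ, ENNReal.ofReal_le_ofReal_iff ENNReal.toReal_nonneg] at this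
    have hDfe : discreteEnergy (N k) (extend γ) =
      N k / 2 * ∑ i ∈ Finset.range (N k), dist (f i) (f (i + 1)) ^ 2 := rfl
    have hDge : discreteEnergy (N k) (extend ρ) =
      N k / 2 * ∑ i ∈ Finset.range (N k), dist (g i) (g (i + 1)) ^ 2 := rfl
    have hem' : e (k + 1) = em := by
      have : ((k + 1 : ℕ) : ℝ) / (N k : ℕ) = 1 / 2 := by
        simp only [hN]; push_cast; field_simp
      simp only [he, hg, hem, this]
    have he0' : e 0 = e0 := by
      have := extend_recoveryCurve hE hη hε.le γ (t := 0) (by simp)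
      simp only [he, hg, he0, Nat.cast_zero, zero_div, hρ, this]
      simp [extend]
    have he1' : e (2 * (k + 1)) = e1 := by
      have h2 : ((2 * (k + 1) : ℕ) : ℝ) / (N k : ℕ) = 1 := div_self hNk.ne'
      have := extend_recoveryCurve hE hη hε.le γ (t := 1) (by simp)
      simp only [he, hg, he1, h2, hρ, this]
      simp [extend]
    rw [hem', he0', he1'] at hsum
    set SD := ∑ i ∈ Finset.range (N k), dist (g i) (g (i + 1)) ^ 2 with hSD
    set SF := ∑ i ∈ Finset.range (N k), dist (f i) (f (i + 1)) ^ 2 with hSF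
    have hSD0 : 0 ≤ SD := Finset.sum_nonneg fun _ _ => sq_nonneg _
    have hSL : ∑ i ∈ Finset.range (N k), ε ^ 2 / 2 * ℓ i ^ 2 * (1 / N k) =
        ε ^ 2 / 2 * (∑ i ∈ Finset.range (N k), ℓ i ^ 2) * (1 / N k) := by
      rw [Finset.mul_sum, Finset.sum_mul]
    set SL := ∑ i ∈ Finset.range (N k), ℓ i ^ 2 with hSLdef
    have hSL0 : 0 ≤ SL := Finset.sum_nonneg fun _ _ => sq_nonneg _
    have hsum' : Real.exp (lam * δ) / 2 * SD + Real.exp (-(3 * |lam| * δ)) * SL * (δ ^ 2 / 2) +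
        I * (2 * em - e0 - e1) ≤ Real.exp (2 * |lam| * (η + ε)) * SF / 2 := hsum
    have hexp1 : Real.exp (-(3 * |lam| * δ)) ≤ Real.exp (lam * δ) := by
      apply Real.exp_le_exp.2
      have h2 : -|lam| * δ ≤ lam * δ := by gcongr; exact neg_abs_le _
      have h3 : 0 ≤ |lam| * δ := by positivity
      linarith
    have hmain : Real.exp (-(3 * |lam| * δ)) * (N k / 2 * SD + ε ^ 2 / 2 * SL * (1 / N k)) ≤
        Real.exp (2 * |lam| * (η + ε)) * A - N k * I * (2 * em - e0 - e1) := by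
      have h2 : Real.exp (-(3 * |lam| * δ)) * SD ≤ Real.exp (lam * δ) * SD := by gcongr
      have h3 : Real.exp (2 * |lam| * (η + ε)) * (N k / 2 * SF) ≤
          Real.exp (2 * |lam| * (η + ε)) * A := by
        rw [← hDfe]; gcongr
      have h4 := mul_le_mul_of_nonneg_left hsum' hNk.le
      have h5 := mul_le_mul_of_nonneg_left h2 hNk.le
      -- Since δ = ε/N, the factor N δ² equals ε²/N: the Riemann weight 1/N with the coefficient ε²
      -- of the Fisher term.
      have h6 : (N k : ℝ) * (SL * (δ ^ 2 / 2)) = ε ^ 2 / 2 * SL * (1 / N k) := by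
        rw [hδ]; field_simp
      have h7 : (N k : ℝ) * (Real.exp (-(3 * |lam| * δ)) * SL * (δ ^ 2 / 2)) =
          Real.exp (-(3 * |lam| * δ)) * (ε ^ 2 / 2 * SL * (1 / N k)) := by
        rw [← h6]; ring
      linarith
    rw [hSL, hDge]
    have h8 := mul_le_mul_of_nonneg_left hmain (Real.exp_pos (3 * |lam| * δ)).le
    rw [← mul_assoc, ← Real.exp_add, add_neg_cancel, Real.exp_zero, one_mul] at h8
    exact h8
  have hBlim : Tendsto B atTop (𝓝 (Real.exp (2 * |lam| * (η + ε)) * A +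
      ε * (e0 + e1 - 2 * em))) := by
    have l1 : Tendsto (fun k => Real.exp (3 * |lam| * (ε / N k))) atTop (𝓝 1) := by
      have : Tendsto (fun k => ε / (N k : ℝ)) atTop (𝓝 0) := tendsto_const_nhds.div_atTop hNR
      have hcont : Continuous fun x => Real.exp (3 * |lam| * x) := by fun_prop
      simpa [Function.comp_def] using (hcont.tendsto 0).comp this
    have l2 := tendsto_mul_integral_exp lam ε hε hNR
    have l3 := l1.mul ((l2.mul_const (2 * em - e0 - e1)).const_sub
      (Real.exp (2 * |lam| * (η + ε)) * A))
    convert l3 using 2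
    ring
  have hfisher : ENNReal.ofReal (ε ^ 2) * fisherInformation E ρ ≤ ∫⁻ t in Icc (0 : ℝ) 1, F t := by
    unfold fisherInformation
    rw [← mul_assoc]
    have e2 : ENNReal.ofReal (ε ^ 2) * (1 / 2) = c := by
      rw [hc, ENNReal.ofReal_div_of_pos (by norm_num)]
      simp [div_eq_mul_inv]
    rw [e2, ← lintegral_const_mul' _ _ ENNReal.ofReal_ne_top]
    refine lintegral_mono fun t => ?_
    simp only [hF]
    gcongr
    exact slope_le_globalSlope hE _
  calc action E ε ρ ≤ liminf (fun k => ENNReal.ofReal (discreteEnergy (N k) (extend ρ))) atTop +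
        liminf (fun k => ∑ i ∈ Finset.range (N k), F (J k i / N k) * ENNReal.ofReal (1 / N k))
          atTop := add_le_add hkin (hfisher.trans hfis)
    _ ≤ liminf (fun k => ENNReal.ofReal (discreteEnergy (N k) (extend ρ)) +
        ∑ i ∈ Finset.range (N k), F (J k i / N k) * ENNReal.ofReal (1 / N k)) atTop :=
        liminf_add_liminf_le _ _
    _ ≤ liminf (fun k => ENNReal.ofReal (B k)) atTop :=
        liminf_le_liminf (Eventually.of_forall hstep)
    _ = _ := (ENNReal.tendsto_ofReal hBlim).liminf_eq

end Recovery

/-! ### The lower bound, and comparison of d with σ. -/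

theorem sum_liminf_le_liminf_sum {ι : Type*} (s : Finset ι) (a : ι → ℕ → ℝ≥0∞) :
    ∑ i ∈ s, liminf (a i) atTop ≤ liminf (fun n => ∑ i ∈ s, a i n) atTop := by
  classical
  induction s using Finset.induction_on with
  | empty => simp
  | insert i s hi ih =>
    simp only [Finset.sum_insert hi]
    exact (add_le_add le_rfl ih).trans (liminf_add_liminf_le _ _)

theorem ofReal_discreteEnergy (N : ℕ) (f : ℝ → X) :
    ENNReal.ofReal (discreteEnergy N f) =
      ∑ i ∈ Finset.range N,
        ENNReal.ofReal (N / 2) * edist (f (i / N)) (f ((i + 1 : ℕ) / N)) ^ 2 := by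
  rw [discreteEnergy, Finset.mul_sum, ENNReal.ofReal_sum_of_nonneg fun _ _ => by positivity]
  refine Finset.sum_congr rfl fun i _ => ?_
  rw [ENNReal.ofReal_mul (by positivity), edist_dist, ENNReal.ofReal_pow dist_nonneg]

theorem kineticEnergy_le_liminf {u : ℕ → Curve X} {γ : Curve X}
    (h : ∀ s t, edist (γ s) (γ t) ≤ liminf (fun n => edist (u n s) (u n t)) atTop) :
    kineticEnergy γ ≤ liminf (fun n => kineticEnergy (u n)) atTop := by
  refine (kineticEnergy_le_liminf_discreteEnergy γ tendsto_id).trans ?_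
  refine (liminf_le_liminf (Eventually.of_forall fun N => ?_)).trans (liminf_const _).le
  calc ENNReal.ofReal (discreteEnergy N (extend γ))
      ≤ liminf (fun n => ENNReal.ofReal (discreteEnergy N (extend (u n)))) atTop := by
        simp only [ofReal_discreteEnergy]
        refine le_trans (Finset.sum_le_sum fun i _ => ?_) (sum_liminf_le_liminf_sum _ _)
        have hcont : Continuous fun x : ℝ≥0∞ => ENNReal.ofReal (N / 2) * x ^ 2 :=
          (ENNReal.continuous_const_mul ENNReal.ofReal_ne_top).comp (ENNReal.continuous_pow 2)
        have hmono : Monotone fun x : ℝ≥0∞ => ENNReal.ofReal (N / 2) * x ^ 2 := fun a b hab => by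
          simp only
          gcongr
        have := hmono.map_liminf_of_continuousAt (F := atTop)
          (fun n => edist (extend (u n) (i / N)) (extend (u n) ((i + 1 : ℕ) / N)))
          hcont.continuousAt
        exact (hmono (h _ _)).trans this.le
    _ ≤ _ := liminf_le_liminf (Eventually.of_forall fun n =>
        ofReal_discreteEnergy_le_kineticEnergy N (u n))

/-- The lower bound of the `Γ`-convergence, for any convergence of curves along which distances
are lower semicontinuous. -/
theorem le_liminf_action_add_endpointIndicator {E : X → EReal} {ε : ℕ → ℝ} {x y : X}
    {xs ys : ℕ → X} (hx : Tendsto xs atTop (𝓝 x)) (hy : Tendsto ys atTop (𝓝 y))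
    {u : ℕ → Curve X} {γ : Curve X}
    (h : ∀ s t, edist (γ s) (γ t) ≤ liminf (fun n => edist (u n s) (u n t)) atTop)
    (h' : ∀ t z, edist (γ t) z ≤ liminf (fun n => edist (u n t) z) atTop) :
    kineticEnergy γ + endpointIndicator x y γ ≤
      liminf (fun n => action E (ε n) (u n) + endpointIndicator (xs n) (ys n) (u n)) atTop := by
  by_cases htop : liminf (fun n => action E (ε n) (u n) +
      endpointIndicator (xs n) (ys n) (u n)) atTop = ⊤
  · rw [htop]; exact le_top
  have hfreq := frequently_lt_of_liminf_lt (by isBoundedDefault) (lt_top_iff_ne_top.2 htop)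
  have hend : ∃ᶠ n in atTop, u n 0 = xs n ∧ u n 1 = ys n := by
    refine hfreq.mono fun n hn => ?_
    by_contra hcon
    rw [endpointIndicator, if_neg hcon, add_top] at hn
    exact lt_irrefl _ hn
  -- A finite liminf gives the end point constraint for infinitely many n only; semicontinuity of
  -- the distance to a fixed point still identifies the limit.
  have hlim : ∀ (t : unitInterval) (z : X) (zs : ℕ → X), Tendsto zs atTop (𝓝 z) →
      (∃ᶠ n in atTop, u n t = zs n) → γ t = z := by
    intro t z zs hz hf
    rw [← edist_le_zero]
    refine (h' t z).trans (le_of_forall_gt_imp_ge_of_dense fun c hc => ?_)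
    refine liminf_le_of_frequently_le' ?_
    have hev : ∀ᶠ n in atTop, edist (zs n) z < c :=
      (tendsto_iff_edist_tendsto_0.1 hz).eventually (gt_mem_nhds hc)
    refine (hf.and_eventually hev).mono fun n hn => ?_
    rw [hn.1]
    exact hn.2.le
  have h0 := hlim 0 x xs hx (hend.mono fun n hn => hn.1)
  have h1 := hlim 1 y ys hy (hend.mono fun n hn => hn.2)
  rw [endpointIndicator, if_pos ⟨h0, h1⟩, add_zero]
  refine (kineticEnergy_le_liminf h).trans (liminf_le_liminf (Eventually.of_forall fun n => ?_))
  exact (le_add_right le_rfl : kineticEnergy (u n) ≤ action E (ε n) (u n)).trans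
    (le_add_right le_rfl)

/-- Every subsequence has a further one converging in σ, and lower semicontinuity of d against the
constant sequence z forces its limit to be z. Hence a uniform recovery sequence also serves for σ.
-/
theorem tendsto_sigma_of_tendsto {E : X → EReal} {σ : TopologicalSpace X}
    (hσ : SigmaAssumption E σ) {u : ℕ → X} {z : X}
    (hu : Tendsto u atTop (@nhds X UniformSpace.toTopologicalSpace z)) :
    Tendsto u atTop (@nhds X σ z) := by
  refine tendsto_of_subseq_tendsto fun ns hns => ?_
  have hsub := hu.comp hns
  obtain ⟨z', φ, hφ, hz'⟩ := hσ.seq_compact _ (Metric.isBounded_range_of_tendsto _ hsub)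
    (fun n => u (ns n)) (fun n => mem_range_self (f := u ∘ ns) n)
  refine ⟨φ, ?_⟩
  have hconst : Tendsto (fun _ : ℕ => z) atTop (@nhds X σ z) := @tendsto_const_nhds X σ ℕ z atTop
  have hle := hσ.dist_seq_lsc _ _ _ _ hz' hconst
  have hlim := tendsto_iff_edist_tendsto_0.1 (hsub.comp hφ.tendsto_atTop)
  have : edist z' z ≤ 0 := hle.trans hlim.liminf_eq.le
  rw [edist_le_zero] at this
  exact this ▸ hz'

/-! ### The recovery sequence. -/

section Recovery

variable {E : X → EReal} {lam : ℝ} {ε η : ℕ → ℝ}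

theorem tendsto_semigroup (hE : StandingAssumptions E lam) (x : X) (hη_nonneg : ∀ n, 0 ≤ η n)
    (hη : Tendsto η atTop (𝓝 0)) :
    Tendsto (fun n => semigroup E lam (η n) x) atTop (𝓝 x) := by
  have h := (continuousOn_semigroup hE x 0 (mem_Ici.2 le_rfl)).tendsto.comp
    (tendsto_nhdsWithin_iff.2 ⟨hη, Eventually.of_forall hη_nonneg⟩)
  simpa [Function.comp_def, semigroup_zero] using h

theorem uniformConv_recoveryCurve (hE : StandingAssumptions E lam) (hε_nonneg : ∀ n, 0 ≤ ε n)
    (hε : Tendsto ε atTop (𝓝 0)) (hη_nonneg : ∀ n, 0 ≤ η n) (hη : Tendsto η atTop (𝓝 0))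
    (γ : Curve X) :
    UniformConv (fun n => recoveryCurve hE (hη_nonneg n) (hε_nonneg n) γ) γ := by
  have hcont : ContinuousOn (fun p : ℝ × unitInterval => semigroup E lam p.1 (γ p.2))
      (Icc (0 : ℝ) 1 ×ˢ univ) :=
    (continuousOn_uncurry_semigroup hE).comp
      (f := fun p : ℝ × unitInterval => (p.1, γ p.2)) (by fun_prop)
      fun p hp => ⟨hp.1.1, mem_univ _⟩
  have huc := (isCompact_Icc.prod isCompact_univ).uniformContinuousOn_of_continuous hcont
  rw [Metric.uniformContinuousOn_iff] at huc
  rw [UniformConv, Metric.tendstoUniformly_iff]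
  intro e he
  obtain ⟨δ, hδ, hd⟩ := huc e he
  have hsum : Tendsto (fun n => η n + ε n) atTop (𝓝 0) := by simpa using hη.add hε
  filter_upwards [hsum.eventually (gt_mem_nhds (lt_min hδ one_pos))] with n hn t
  have hm0 : 0 ≤ min (t : ℝ) (1 - t) := le_min t.2.1 (by linarith [t.2.2])
  have hm1 : min (t : ℝ) (1 - t) ≤ 1 := (min_le_left _ _).trans t.2.2
  have h0 : 0 ≤ η n + ε n * min (t : ℝ) (1 - t) :=
    add_nonneg (hη_nonneg n) (mul_nonneg (hε_nonneg n) hm0)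
  have h1 : η n + ε n * min (t : ℝ) (1 - t) ≤ η n + ε n := by
    have := mul_le_mul_of_nonneg_left hm1 (hε_nonneg n)
    linarith
  have h2 := h1.trans_lt hn
  rw [lt_min_iff] at h2
  have := hd (0, t) ⟨by simp, mem_univ _⟩ (η n + ε n * min (t : ℝ) (1 - t), t)
    ⟨⟨h0, h2.2.le⟩, mem_univ _⟩ (by
      rw [Prod.dist_eq, dist_self, Real.dist_eq, zero_sub, abs_neg, abs_of_nonneg h0]
      exact max_lt h2.1 hδ)
  simpa [semigroup_zero, recoveryCurve] using this

theorem recoveryCurve_zero (hE : StandingAssumptions E lam) {η ε : ℝ} (hη : 0 ≤ η) (hε : 0 ≤ ε)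
    (γ : Curve X) : recoveryCurve hE hη hε γ 0 = semigroup E lam η (γ 0) := by
  simp [recoveryCurve]

theorem recoveryCurve_one (hE : StandingAssumptions E lam) {η ε : ℝ} (hη : 0 ≤ η) (hε : 0 ≤ ε)
    (γ : Curve X) : recoveryCurve hE hη hε γ 1 = semigroup E lam η (γ 1) := by
  simp [recoveryCurve]

theorem eventually_ne_top_and_tendsto_toReal {a b : ℕ → EReal} (ha : ∀ n, a n ≠ ⊥)
    (hb : ∀ n, b n ≠ ⊥) (hε_pos : ∀ n, 0 < ε n)
    (h : Tendsto (fun n => (ε n : EReal) * (a n + b n)) atTop (𝓝 0)) :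
    (∀ᶠ n in atTop, a n ≠ ⊤ ∧ b n ≠ ⊤) ∧
      Tendsto (fun n => ε n * ((a n).toReal + (b n).toReal)) atTop (𝓝 0) := by
  have hfin : ∀ᶠ n in atTop, a n ≠ ⊤ ∧ b n ≠ ⊤ := by
    filter_upwards [h.eventually (gt_mem_nhds (EReal.zero_lt_top))] with n hn
    have hne : a n + b n ≠ ⊤ := by
      intro htop
      rw [htop, EReal.coe_mul_top_of_pos (hε_pos n)] at hn
      exact lt_irrefl _ hn
    constructor
    · intro htop
      rw [htop, EReal.top_add_of_ne_bot (hb n)] at hne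
      exact hne rfl
    · intro htop
      rw [htop, EReal.add_top_of_ne_bot (ha n)] at hne
      exact hne rfl
  refine ⟨hfin, ?_⟩
  rw [← EReal.tendsto_coe]
  refine h.congr' ?_
  filter_upwards [hfin] with n hn
  rw [EReal.coe_mul, EReal.coe_add, EReal.coe_toReal hn.1 (ha n), EReal.coe_toReal hn.2 (hb n)]

/-- A recovery sequence for the `Γ`-convergence in the uniform topology. -/
theorem exists_recovery_sequence (hE : StandingAssumptions E lam) (x y : X)
    (hε_pos : ∀ n, 0 < ε n) (hε : Tendsto ε atTop (𝓝 0))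
    (hη_nonneg : ∀ n, 0 ≤ η n) (hη : Tendsto η atTop (𝓝 0))
    (hslow : Tendsto (fun n => (ε n : EReal) *
      (E (semigroup E lam (η n) x) + E (semigroup E lam (η n) y))) atTop (𝓝 0)) (γ : Curve X) :
    ∃ u : ℕ → Curve X, UniformConv u γ ∧
      limsup (fun n => action E (ε n) (u n) +
        endpointIndicator (semigroup E lam (η n) x) (semigroup E lam (η n) y) (u n)) atTop ≤
      kineticEnergy γ + endpointIndicator x y γ := by
  by_cases htop : kineticEnergy γ + endpointIndicator x y γ = ⊤
  · rw [htop]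
    refine ⟨fun _ => γ, fun s hs => Eventually.of_forall fun _ t => ?_, le_top⟩
    exact refl_mem_uniformity hs
  have hγ : kineticEnergy γ ≠ ⊤ := fun h => htop (by rw [h, top_add])
  have hend : γ 0 = x ∧ γ 1 = y := by
    by_contra hcon
    rw [endpointIndicator, if_neg hcon, add_top] at htop
    exact htop rfl
  obtain ⟨rfl, rfl⟩ := hend
  set u : ℕ → Curve X := fun n => recoveryCurve hE (hη_nonneg n) (hε_pos n).le γ with hu
  have hconv : UniformConv u γ :=
    uniformConv_recoveryCurve hE (fun n => (hε_pos n).le) hε hη_nonneg hη γ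
  refine ⟨u, hconv, ?_⟩
  obtain ⟨hfin, hreal⟩ := eventually_ne_top_and_tendsto_toReal (fun n => hE.ne_bot _)
    (fun n => hE.ne_bot _) hε_pos hslow
  set m : unitInterval := projIcc 0 1 zero_le_one (1 / 2) with hm
  -- The midpoints converge to the midpoint of γ, so a lower bound of E on one ball suffices.
  obtain ⟨c, hc⟩ := hE.bddBelow_of_isBounded _ (Metric.isBounded_ball (x := γ m) (r := 1))
  have hmid : ∀ᶠ n in atTop, c ≤ (E (extend (u n) (1 / 2))).toReal := by
    filter_upwards [(hconv.tendsto_at m).eventually (Metric.ball_mem_nhds _ one_pos)] with n hn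
    -- Finiteness matters because `toReal` sends ⊤ to 0, which need not be above `c`; it holds as
    -- the flow time at the midpoint is at least ε/2.
    have hne : E (extend (u n) (1 / 2)) ≠ ⊤ := by
      rw [hu, extend_recoveryCurve hE (hη_nonneg n) (hε_pos n).le γ (by norm_num)]
      refine energy_semigroup_ne_top hE _ ?_
      have := hε_pos n
      have := hη_nonneg n
      norm_num
      positivity
    have h1 := hc _ hn
    rw [← EReal.coe_le_coe_iff, EReal.coe_toReal hne (hE.ne_bot _)]
    exact h1
  set A := (kineticEnergy γ).toReal with hA
  set B : ℕ → ℝ := fun n => Real.exp (2 * |lam| * (η n + ε n)) * A +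
    (ε n * ((E (semigroup E lam (η n) (γ 0))).toReal +
      (E (semigroup E lam (η n) (γ 1))).toReal) - ε n * (2 * c)) with hB
  have hbound : ∀ᶠ n in atTop, action E (ε n) (u n) +
      endpointIndicator (semigroup E lam (η n) (γ 0)) (semigroup E lam (η n) (γ 1)) (u n) ≤
      ENNReal.ofReal (B n) := by
    filter_upwards [hfin, hmid] with n hn hmn
    rw [endpointIndicator, if_pos ⟨recoveryCurve_zero hE _ _ γ, recoveryCurve_one hE _ _ γ⟩,
      add_zero]
    refine (action_recoveryCurve_le hE (hη_nonneg n) (hε_pos n) γ hγ hn.1 hn.2).trans ?_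
    apply ENNReal.ofReal_le_ofReal
    have := mul_le_mul_of_nonneg_left hmn (hε_pos n).le
    simp only [hB]
    linarith
  have hBlim : Tendsto B atTop (𝓝 A) := by
    have l1 : Tendsto (fun n => Real.exp (2 * |lam| * (η n + ε n))) atTop (𝓝 1) := by
      have hcont : Continuous fun r => Real.exp (2 * |lam| * r) := by fun_prop
      have h0 : Tendsto (fun n => η n + ε n) atTop (𝓝 0) := by simpa using hη.add hε
      simpa [Function.comp_def] using (hcont.tendsto 0).comp h0
    have l2 := (l1.mul_const A).add (hreal.sub (hε.mul_const (2 * c)))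
    simpa using l2
  rw [endpointIndicator, if_pos ⟨rfl, rfl⟩, add_zero]
  calc _ ≤ limsup (fun n => ENNReal.ofReal (B n)) atTop := limsup_le_limsup hbound
    _ = ENNReal.ofReal A := (ENNReal.tendsto_ofReal hBlim).limsup_eq
    _ = _ := ENNReal.ofReal_toReal hγ

end Recovery

end MetricSchrodinger

end

open MetricSchrodinger in
theorem theorem4p5 {X : Type*} [MetricSpace X] [CompleteSpace X]
    [TopologicalSpace.SeparableSpace X] (E : X → EReal) (lam : ℝ)
    (hE : StandingAssumptions E lam) (x y : X)
    (ε η : ℕ → ℝ) (hε_pos : ∀ n, 0 < ε n) (hε : Tendsto ε atTop (𝓝 0))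
    (hη_nonneg : ∀ n, 0 ≤ η n) (hη : Tendsto η atTop (𝓝 0))
    (hslow : Tendsto (fun n => (ε n : EReal) *
      (E (semigroup E lam (η n) x) + E (semigroup E lam (η n) y))) atTop (𝓝 0)) :
    GammaConverges UniformConv
      (fun n (γ : Curve X) => action E (ε n) γ +
        endpointIndicator (semigroup E lam (η n) x) (semigroup E lam (η n) y) γ)
      (fun γ => kineticEnergy γ + endpointIndicator x y γ) ∧
    ∀ σ : TopologicalSpace X, SigmaAssumption E σ →
      GammaConverges (PointwiseConv σ)
        (fun n (γ : Curve X) => action E (ε n) γ +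
          endpointIndicator (semigroup E lam (η n) x) (semigroup E lam (η n) y) γ)
        (fun γ => kineticEnergy γ + endpointIndicator x y γ) := by
  have hx := tendsto_semigroup hE x hη_nonneg hη
  have hy := tendsto_semigroup hE y hη_nonneg hη
  refine ⟨⟨fun u γ hu => ?_, fun γ => ?_⟩, fun σ hσ => ⟨fun u γ hu => ?_, fun γ => ?_⟩⟩
  · refine le_liminf_action_add_endpointIndicator hx hy (fun s t => ?_) (fun t z => ?_)
    · exact ((hu.tendsto_at s).edist (hu.tendsto_at t)).liminf_eq.ge
    · exact ((hu.tendsto_at t).edist tendsto_const_nhds).liminf_eq.ge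
  · exact exists_recovery_sequence hE x y hε_pos hε hη_nonneg hη hslow γ
  · refine le_liminf_action_add_endpointIndicator hx hy (fun s t => ?_) (fun t z => ?_)
    · exact hσ.dist_seq_lsc _ _ _ _ (hu s) (hu t)
    · exact hσ.dist_seq_lsc _ _ _ _ (hu t) (@tendsto_const_nhds X σ ℕ z atTop)
  · obtain ⟨u, hu, hle⟩ := exists_recovery_sequence hE x y hε_pos hε hη_nonneg hη hslow γ
    exact ⟨u, fun t => tendsto_sigma_of_tendsto hσ (hu.tendsto_at t), hle⟩
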